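/- Let $(M_{2k},\varphi,g)$ be an anti-paraKähler manifold: $M$ is a smooth manifold of dimension $n=2k$, $g$ a Riemannian metric, and $\varphi$ a smooth field of endomorphisms of $TM$ with $\varphi^2=\mathrm{id}$, whose eigenbundles for $+1$ and $-1$ have the same rank, with $g(\varphi X,\varphi Y)=g(X,Y)$ and $\nabla\varphi=0$, where $\nabla$ is the Levi-Civita connection of $g$. Let $\delta$ be a real constant. In the coordinates $(x^i,u^i)$ of $TM$ induced by a chart $(x^i)$ of $M$, let $\Gamma_{ij}^h$ be the Christoffel symbols of $\nabla$ and put $$E_i=\frac{\partial}{\partial x^i}-\Gamma^h_{ij}u^j\frac{\partial}{\partial u^h},\qquad E_{\bar i}=\frac{\partial}{\partial u^i}\qquad(1\le i\le n).$$ These span the horizontal and the vertical distribution of $TM$; write $H,V$ for the corresponding projections. The horizontal and vertical lifts of $X=X^i\partial/\partial x^i$ are ${}^HX=X^iE_i$ and ${}^VX=X^iE_{\bar i}$. The Berger type deformed Sasaki metric on $TM$ is defined at $u\in TM$ by $$g_{BS}({}^HX,{}^HY)=g(X,Y),\quad g_{BS}({}^HX,{}^VY)=g_{BS}({}^VX,{}^HY)=0,\quad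 g_{BS}({}^VX,{}^VY)=g(X,Y)+\delta^2g(X,\varphi u)g(Y,\varphi u).$$ Let ${}^{BS}\nabla$ be its Levi-Civita connection, let $$\tilde\nabla_{\tilde X}\tilde Y=V\,{}^{BS}\nabla_{\tilde X}(V\tilde Y)+H\,{}^{BS}\nabla_{\tilde X}(H\tilde Y)$$ be the associated Schouten–van Kampen connection on $TM$, $T(\tilde X,\tilde Y)=\tilde\nabla_{\tilde X}\tilde Y-\tilde\nabla_{\tilde Y}\tilde X-[\tilde X,\tilde Y]$ its torsion, and $\overset{m}{\nabla}=\tilde\nabla-\tfrac12T$ its mean connection. For a map $f$ from a manifold with a connection ${}^M\nabla$ to a manifold with a connection ${}^N\nabla$, the second fundamental form $\beta(f)$ is given in coordinates by $$\beta(f)(\partial_i,\partial_j)^\gamma=\partial_i\partial_jf^\gamma-{}^M\Gamma_{ij}^k\,\partial_kf^\gamma+{}^N\Gamma^\gamma_{\alpha\beta}\,\partial_if^\alpha\,\partial_jf^\beta ,$$ and the tension field $\tau(f)$ is the trace of $\beta(f)$ with respect to the metric of the source. Consider the identity map $I:(TM,g_{BS})\to(TM,\overset{m}{\nabla})$, where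 the source carries the connection ${}^{BS}\nabla$. Then, in every induced chart and at every point $u=u^i\partial/\partial x^i$ of $TM$ in it, for all $i,j$, $$\beta(I)(E_i,E_j)=0,\qquad \beta(I)(E_{\bar i},E_{\bar j})=0,\qquad \beta(I)(E_{\bar i},E_j)=\beta(I)(E_j,E_{\bar i})=\tfrac14R^{h}_{.j0i}E_h ,$$ where $R(\partial_i,\partial_j)\partial_k=R_{ijk}{}^h\partial_h$ are the components of the curvature tensor $R(X,Y)Z=\nabla_X\nabla_YZ-\nabla_Y\nabla_XZ-\nabla_{[X,Y]}Z$ of $g$ and $R^{h}_{.j0i}=u^m R_{ljm}{}^s\,g^{lh}g_{si}$ (repeated indices are summed). Consequently $\tau(I)=0$ on $TM$. Moreover, if $R$ is not identically zero, then $\beta(I)$ is not identically zero. -/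

import Mathlib

set_option maxSynthPendingDepth 3

open Bundle Manifold
open scoped ContDiff

noncomputable section

namespace BergerSasaki

/-! ## Metrics, linear connections and maps in a coordinate domain

`F` is the coordinate space. All objects below only depend on the data near the point `x` at which
they are evaluated. -/

section Coordinates

variable {F : Type*} [NormedAddCommGroup F] [NormedSpace ℝ F]

/-- The trilinear map `a, b, c ↦ ∂_c G_{ab}`. -/
def derivLast (G : F → F →L[ℝ] F →L[ℝ] ℝ) (x : F) : F →L[ℝ] F →L[ℝ] F →L[ℝ] ℝ :=
  (ContinuousLinearMap.flipₗᵢ ℝ F F ℝ).toContinuousLinearEquiv.toContinuousLinearMap ∘L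
    (fderiv ℝ G x).flip

/-- The first-kind Christoffel symbols `½ (∂_a G_{bc} + ∂_b G_{ac} - ∂_c G_{ab})` of a metric `G`,
as a trilinear map in `a, b, c`. -/
def christoffelFirst (G : F → F →L[ℝ] F →L[ℝ] ℝ) (x : F) : F →L[ℝ] F →L[ℝ] F →L[ℝ] ℝ :=
  (1 / 2 : ℝ) • (fderiv ℝ G x + (fderiv ℝ G x).flip - derivLast G x)

theorem christoffelFirst_apply (G : F → F →L[ℝ] F →L[ℝ] ℝ) (x a b c : F) :
    christoffelFirst G x a b c =
      (1 / 2 : ℝ) * (fderiv ℝ G x a b c + fderiv ℝ G x b a c - fderiv ℝ G x c a b) := by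
  simp [christoffelFirst, derivLast]

/-- The Christoffel symbols (second kind) of the Levi-Civita connection of a metric `G`: the vector
`Γ x a b` is the one with `G x (Γ x a b) c = ½ (∂_a G_{bc} + ∂_b G_{ac} - ∂_c G_{ab})` for all `c`.
Thus `Γ x ∂_i ∂_j = Γ_{ij}^h ∂_h`. -/
def christoffel (G : F → F →L[ℝ] F →L[ℝ] ℝ) (x : F) : F →L[ℝ] F →L[ℝ] F :=
  (ContinuousLinearMap.compL ℝ F (F →L[ℝ] ℝ) F (G x).inverse) ∘L christoffelFirst G x

theorem christoffel_apply (G : F → F →L[ℝ] F →L[ℝ] ℝ) (x a b : F) :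
    christoffel G x a b = (G x).inverse (christoffelFirst G x a b) := rfl

/-- A connection in a coordinate domain, as an operator `(X, Y) ↦ ∇_X Y` on vector fields. -/
abbrev Connection (F : Type*) := (F → F) → (F → F) → F → F

/-- The connection with Christoffel symbols `Γ`: `∇_X Y = DY(X) + Γ(X, Y)`. -/
def covDeriv (Γ : F → F →L[ℝ] F →L[ℝ] F) : Connection F :=
  fun X Y x ↦ fderiv ℝ Y x (X x) + Γ x (X x) (Y x)

/-- The Levi-Civita connection of a metric. -/
def leviCivita (G : F → F →L[ℝ] F →L[ℝ] ℝ) : Connection F := covDeriv (christoffel G)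

/-- The components `C_{∂_a} ∂_b` of a connection in the given coordinates. -/
def components (C : Connection F) (x a b : F) : F := C (fun _ ↦ a) (fun _ ↦ b) x

/-- The torsion `T(X, Y) = C_X Y - C_Y X - [X, Y]` of a connection. -/
def torsion (C : Connection F) (X Y : F → F) (x : F) : F :=
  C X Y x - C Y X x - VectorField.lieBracket ℝ X Y x

/-- The mean connection `C - ½ T` of a connection `C` with torsion `T`. -/
def meanConnection (C : Connection F) : Connection F :=
  fun X Y x ↦ C X Y x - (1 / 2 : ℝ) • torsion C X Y x

/-- The curvature `R(X, Y) Z = C_X C_Y Z - C_Y C_X Z - C_{[X, Y]} Z` of a connection. -/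
def curvature (C : Connection F) (X Y Z : F → F) (x : F) : F :=
  C X (C Y Z) x - C Y (C X Z) x - C (VectorField.lieBracket ℝ X Y) Z x

/-- The curvature tensor of a metric on coordinate vectors, `R(∂_i, ∂_j) ∂_k = R_{ijk}^h ∂_h`. -/
def riemann (G : F → F →L[ℝ] F →L[ℝ] ℝ) (x a b c : F) : F :=
  curvature (leviCivita G) (fun _ ↦ a) (fun _ ↦ b) (fun _ ↦ c) x

/-- The second fundamental form of a map `f` between coordinate domains with Christoffel symbols
`ΓM` and `ΓN`: `β(f)(∂_i, ∂_j)^γ = ∂_i ∂_j f^γ - ΓM_{ij}^k ∂_k f^γ + ΓN_{αβ}^γ ∂_i f^α ∂_j f^β`. -/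
def secondFundamentalForm {F' : Type*} [NormedAddCommGroup F'] [NormedSpace ℝ F']
    (ΓM : F → F → F → F) (ΓN : F' → F' → F' → F') (f : F → F') (x a b : F) : F' :=
  fderiv ℝ (fun y ↦ fderiv ℝ f y b) x a - fderiv ℝ f x (ΓM x a b)
    + ΓN (f x) (fderiv ℝ f x a) (fderiv ℝ f x b)

/-- The trace `G^{AB} β(∂_A, ∂_B)` of a bilinear map `β` with respect to a metric `G`, where
`∂_A` is the coordinate basis and `(G^{AB})` is the inverse of the matrix `(G_{AB})`. -/
def metricTrace {ι V : Type*} [Fintype ι] [DecidableEq ι] [AddCommGroup V] [Module ℝ V]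
    (basis : Module.Basis ι ℝ F) (G : F →L[ℝ] F →L[ℝ] ℝ) (β : F → F → V) : V :=
  ∑ A, ∑ B, (Matrix.of fun i j ↦ G (basis i) (basis j))⁻¹ A B • β (basis A) (basis B)

end Coordinates

/-! ## The tangent bundle in induced coordinates

`E` is the coordinate space of the base; a point of the tangent bundle has induced coordinates
`z = (x, u) ∈ E × E`, and tangent vectors to the tangent bundle have components in `E × E` too. -/

section TangentCoordinates

variable {E : Type*} [NormedAddCommGroup E] [NormedSpace ℝ E]

/-- The horizontal lift at `z = (x, u)`: `∂_i ↦ E_i = ∂/∂x^i - Γ_{ij}^h u^j ∂/∂u^h`. -/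
def hLift (g : E → E →L[ℝ] E →L[ℝ] ℝ) (z : E × E) (a : E) : E × E :=
  (a, -christoffel g z.1 a z.2)

/-- The vertical lift: `∂_i ↦ ∂/∂u^i`. -/
def vLift (a : E) : E × E := (0, a)

/-- The forms `δu^i = du^i + Γ_{hj}^i u^j dx^h` (the second half of the dual adapted frame). -/
def deltaU (g : E → E →L[ℝ] E →L[ℝ] ℝ) (z : E × E) : E × E →L[ℝ] E :=
  ContinuousLinearMap.snd ℝ E E + (christoffel g z.1).flip z.2 ∘L ContinuousLinearMap.fst ℝ E E

/-- The projection onto the horizontal distribution along the vertical one. -/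
def hProj (g : E → E →L[ℝ] E →L[ℝ] ℝ) (z ξ : E × E) : E × E := hLift g z ξ.1

/-- The projection onto the vertical distribution along the horizontal one. -/
def vProj (g : E → E →L[ℝ] E →L[ℝ] ℝ) (z ξ : E × E) : E × E := vLift (deltaU g z ξ)

/-- Every vector is the sum of its horizontal and vertical parts. -/
theorem hProj_add_vProj (g : E → E →L[ℝ] E →L[ℝ] ℝ) (z ξ : E × E) :
    hProj g z ξ + vProj g z ξ = ξ := by
  ext <;> simp [hProj, vProj, hLift, vLift, deltaU]

/-- The Berger type deformed Sasaki metric in induced coordinates. -/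
def bergerSasaki (δ : ℝ) (g : E → E →L[ℝ] E →L[ℝ] ℝ) (φ : E → E →L[ℝ] E) (z : E × E) :
    E × E →L[ℝ] E × E →L[ℝ] ℝ :=
  (g z.1).bilinearComp (ContinuousLinearMap.fst ℝ E E) (ContinuousLinearMap.fst ℝ E E) +
  (g z.1).bilinearComp (deltaU g z) (deltaU g z) +
  δ ^ 2 • ((g z.1).flip (φ z.1 z.2) ∘L deltaU g z).smulRight
    ((g z.1).flip (φ z.1 z.2) ∘L deltaU g z)

theorem bergerSasaki_hLift_hLift (δ : ℝ) (g : E → E →L[ℝ] E →L[ℝ] ℝ) (φ : E → E →L[ℝ] E)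
    (z : E × E) (a b : E) :
    bergerSasaki δ g φ z (hLift g z a) (hLift g z b) = g z.1 a b := by
  simp [bergerSasaki, hLift, deltaU]

theorem bergerSasaki_hLift_vLift (δ : ℝ) (g : E → E →L[ℝ] E →L[ℝ] ℝ) (φ : E → E →L[ℝ] E)
    (z : E × E) (a b : E) :
    bergerSasaki δ g φ z (hLift g z a) (vLift b) = 0 := by
  simp [bergerSasaki, hLift, vLift, deltaU]

theorem bergerSasaki_vLift_hLift (δ : ℝ) (g : E → E →L[ℝ] E →L[ℝ] ℝ) (φ : E → E →L[ℝ] E)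
    (z : E × E) (a b : E) :
    bergerSasaki δ g φ z (vLift a) (hLift g z b) = 0 := by
  simp [bergerSasaki, hLift, vLift, deltaU]

theorem bergerSasaki_vLift_vLift (δ : ℝ) (g : E → E →L[ℝ] E →L[ℝ] ℝ) (φ : E → E →L[ℝ] E)
    (z : E × E) (a b : E) :
    bergerSasaki δ g φ z (vLift a) (vLift b) =
      g z.1 a b + δ ^ 2 * g z.1 a (φ z.1 z.2) * g z.1 b (φ z.1 z.2) := by
  simp [bergerSasaki, vLift, deltaU]; ring

/-- The Schouten-van Kampen connection `V D_X (V Y) + H D_X (H Y)` associated with a connection `D`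
on the tangent bundle and the splitting into horizontal and vertical distributions. -/
def schoutenVanKampen (g : E → E →L[ℝ] E →L[ℝ] ℝ) (D : Connection (E × E)) : Connection (E × E) :=
  fun X Y z ↦ vProj g z (D X (fun w ↦ vProj g w (Y w)) z) +
    hProj g z (D X (fun w ↦ hProj g w (Y w)) z)

/-- The second fundamental form of the identity map from the tangent bundle with the Berger type
deformed Sasaki metric to the tangent bundle with the mean connection of the Schouten-van Kampen
connection associated with the Levi-Civita connection of that metric. -/
def identityForm (δ : ℝ) (g : E → E →L[ℝ] E →L[ℝ] ℝ) (φ : E → E →L[ℝ] E) (z ξ η : E × E) : E × E :=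
  secondFundamentalForm
    (components (leviCivita (bergerSasaki δ g φ)))
    (components (meanConnection (schoutenVanKampen g (leviCivita (bergerSasaki δ g φ)))))
    id z ξ η

end TangentCoordinates

section Indices

variable {n : ℕ}

local notation "𝔼" n => EuclideanSpace ℝ (Fin n)

/-- The coordinate vector `∂_i`. -/
def coordVec (i : Fin n) : 𝔼 n := EuclideanSpace.single i 1

/-- The horizontal part `E_i` of the adapted frame. -/
def horFrame (g : (𝔼 n) → (𝔼 n) →L[ℝ] (𝔼 n) →L[ℝ] ℝ) (z : (𝔼 n) × (𝔼 n)) (i : Fin n) :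
    (𝔼 n) × (𝔼 n) :=
  hLift g z (coordVec i)

/-- The vertical part `E_{n+i} = ∂/∂u^i` of the adapted frame. -/
def verFrame (i : Fin n) : (𝔼 n) × (𝔼 n) := vLift (coordVec i)

/-- The coordinate basis `(∂/∂x^i, ∂/∂u^i)` of the induced coordinates on the tangent bundle. -/
def inducedBasis (n : ℕ) : Module.Basis (Fin n ⊕ Fin n) ℝ ((𝔼 n) × (𝔼 n)) :=
  (EuclideanSpace.basisFun (Fin n) ℝ).toBasis.prod (EuclideanSpace.basisFun (Fin n) ℝ).toBasis

/-- `R_{ijk}^h`. -/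
def riemannComp (g : (𝔼 n) → (𝔼 n) →L[ℝ] (𝔼 n) →L[ℝ] ℝ) (x : 𝔼 n) (i j k h : Fin n) : ℝ :=
  riemann g x (coordVec i) (coordVec j) (coordVec k) h

/-- `R^h_{.j0i} = R_{lj0}^s g^{lh} g_{si}` at `z = (x, u)`, with `R_{lj0}^s = R_{ljm}^s u^m`. -/
def raisedCurvature (g : (𝔼 n) → (𝔼 n) →L[ℝ] (𝔼 n) →L[ℝ] ℝ) (z : (𝔼 n) × (𝔼 n))
    (h j i : Fin n) : ℝ :=
  ∑ l, ∑ s, (∑ m, riemannComp g z.1 l j m s * z.2 m) *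
    (Matrix.of fun p q ↦ g z.1 (coordVec p) (coordVec q))⁻¹ l h *
    g z.1 (coordVec s) (coordVec i)

/-- The tension field (with respect to `g_BS`) of the identity map in `identityForm`. -/
def identityTension (δ : ℝ) (g : (𝔼 n) → (𝔼 n) →L[ℝ] (𝔼 n) →L[ℝ] ℝ) (φ : (𝔼 n) → (𝔼 n) →L[ℝ] 𝔼 n)
    (z : (𝔼 n) × (𝔼 n)) : (𝔼 n) × (𝔼 n) :=
  metricTrace (inducedBasis n) (bergerSasaki δ g φ z) (identityForm δ g φ z)

end Indices

/-! ## Manifolds -/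

section Manifold

variable {E : Type*} [NormedAddCommGroup E] [NormedSpace ℝ E]
  {M : Type*} [TopologicalSpace M] [ChartedSpace E M] [IsManifold 𝓘(ℝ, E) ∞ M]

/-- The differential at `p` of the coordinate map `e`. -/
def chartDeriv (e : OpenPartialHomeomorph M E) (p : M) : TangentSpace 𝓘(ℝ, E) p →L[ℝ] E :=
  mfderiv 𝓘(ℝ, E) 𝓘(ℝ, E) e p

/-- The differential at the coordinate point `x` of the parametrization inverse to `e`; it sends
the `i`-th basis vector to `∂/∂x^i`. -/
def chartSymmDeriv (e : OpenPartialHomeomorph M E) (x : E) :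
    E →L[ℝ] TangentSpace 𝓘(ℝ, E) (e.symm x) :=
  mfderiv 𝓘(ℝ, E) 𝓘(ℝ, E) e.symm x

/-- The induced coordinates `(x, u)` of a tangent vector. -/
def inducedChart (e : OpenPartialHomeomorph M E) (v : TangentBundle 𝓘(ℝ, E) M) : E × E :=
  (e v.proj, chartDeriv e v.proj v.2)

/-- The local expression of a Riemannian metric in a chart. -/
def localMetric (g : ContMDiffRiemannianMetric 𝓘(ℝ, E) ∞ E (fun p : M ↦ TangentSpace 𝓘(ℝ, E) p))
    (e : OpenPartialHomeomorph M E) (x : E) : E →L[ℝ] E →L[ℝ] ℝ :=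
  (chartSymmDeriv e x).precomp ℝ ∘L g.inner (e.symm x) ∘L chartSymmDeriv e x

theorem localMetric_apply
    (g : ContMDiffRiemannianMetric 𝓘(ℝ, E) ∞ E (fun p : M ↦ TangentSpace 𝓘(ℝ, E) p))
    (e : OpenPartialHomeomorph M E) (x a b : E) :
    localMetric g e x a b =
      g.inner (e.symm x) (chartSymmDeriv e x a) (chartSymmDeriv e x b) := rfl

/-- The local expression of a field of endomorphisms in a chart. -/
def localEnd (φ : (p : M) → TangentSpace 𝓘(ℝ, E) p →L[ℝ] TangentSpace 𝓘(ℝ, E) p)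
    (e : OpenPartialHomeomorph M E) (x : E) : E →L[ℝ] E :=
  chartDeriv e (e.symm x) ∘L φ (e.symm x) ∘L chartSymmDeriv e x

/-- An almost anti-paraHermitian manifold: a smooth field `φ` of endomorphisms with `φ² = id`
whose `±1`-eigenbundles have the same rank, and with `g(φX, φY) = g(X, Y)`. -/
structure IsAlmostAntiParaHermitian
    (g : ContMDiffRiemannianMetric 𝓘(ℝ, E) ∞ E (fun p : M ↦ TangentSpace 𝓘(ℝ, E) p))
    (φ : (p : M) → TangentSpace 𝓘(ℝ, E) p →L[ℝ] TangentSpace 𝓘(ℝ, E) p) : Prop where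
  smooth : ContMDiff 𝓘(ℝ, E) (𝓘(ℝ, E).prod 𝓘(ℝ, E →L[ℝ] E)) ∞
    (fun p ↦ TotalSpace.mk' (E →L[ℝ] E)
      (E := fun p : M ↦ TangentSpace 𝓘(ℝ, E) p →L[ℝ] TangentSpace 𝓘(ℝ, E) p) p (φ p))
  involutive : ∀ p X, φ p (φ p X) = X
  rank_eq : ∀ p, Module.finrank ℝ (Module.End.eigenspace (φ p).toLinearMap (1 : ℝ)) =
    Module.finrank ℝ (Module.End.eigenspace (φ p).toLinearMap (-1 : ℝ))
  compatible : ∀ p X Y, g.inner p (φ p X) (φ p Y) = g.inner p X Y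

/-- An anti-paraKähler manifold: moreover `φ` is parallel for the Levi-Civita connection of `g`,
i.e. `(∇_a φ) b = ∇_a (φ b) - φ (∇_a b)` vanishes for coordinate vectors `a, b` of every chart. -/
structure IsAntiParaKahler
    (g : ContMDiffRiemannianMetric 𝓘(ℝ, E) ∞ E (fun p : M ↦ TangentSpace 𝓘(ℝ, E) p))
    (φ : (p : M) → TangentSpace 𝓘(ℝ, E) p →L[ℝ] TangentSpace 𝓘(ℝ, E) p) : Prop
    extends IsAlmostAntiParaHermitian g φ where
  parallel : ∀ e ∈ IsManifold.maximalAtlas 𝓘(ℝ, E) ∞ M, ∀ x ∈ e.target, ∀ a b : E,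
    leviCivita (localMetric g e) (fun _ ↦ a) (fun y ↦ localEnd φ e y b) x -
      localEnd φ e x (leviCivita (localMetric g e) (fun _ ↦ a) (fun _ ↦ b) x) = 0

/-- The Riemannian curvature tensor of `g` is not identically zero. -/
def CurvatureNeZero
    (g : ContMDiffRiemannianMetric 𝓘(ℝ, E) ∞ E (fun p : M ↦ TangentSpace 𝓘(ℝ, E) p)) : Prop :=
  ∃ e ∈ IsManifold.maximalAtlas 𝓘(ℝ, E) ∞ M, ∃ p ∈ e.source, ∃ a b c : E,
    riemann (localMetric g e) (e p) a b c ≠ 0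

/-- The second fundamental form of the identity map of the tangent bundle (see `identityForm`) is
not identically zero. -/
def IdentityFormNeZero (δ : ℝ)
    (g : ContMDiffRiemannianMetric 𝓘(ℝ, E) ∞ E (fun p : M ↦ TangentSpace 𝓘(ℝ, E) p))
    (φ : (p : M) → TangentSpace 𝓘(ℝ, E) p →L[ℝ] TangentSpace 𝓘(ℝ, E) p) : Prop :=
  ∃ e ∈ IsManifold.maximalAtlas 𝓘(ℝ, E) ∞ M, ∃ v : TangentBundle 𝓘(ℝ, E) M, v.proj ∈ e.source ∧
    ∃ ξ η : E × E, identityForm δ (localMetric g e) (localEnd φ e) (inducedChart e v) ξ η ≠ 0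

end Manifold

end BergerSasaki

end

/-! Let `D` be the Levi-Civita connection of the Berger type metric. For the identity map, the
second fundamental form is the difference of the two connections. Subtracting half the torsion
symmetrizes the components of the Schouten–van Kampen connection, and the components of `D` are
already symmetric. What survives is minus one half of the symmetrization in `ξ, η` of `H D_ξ(Vη) + V
D_ξ(Hη)`, the mixed parts of `D` that the Schouten–van Kampen connection discards.

Both mixed parts come from the Koszul formula on horizontal and vertical lifts. The bracket of two
horizontal lifts is the vertical lift of `-R(a, b)u`. Since `∇g = 0` and `∇φ = 0`, the vertical
metric is parallel along horizontal lifts, so all terms except the curvature ones cancel. The part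
`V D_ξ(Hη)` is `-½ R(ξ, η)u`, which is skew and disappears on symmetrizing. The part `H D_ξ(Vη)`
involves the vertical product of `R(a, b)u` with a vector; its `δ²` term vanishes because `R(a, b)u`
is orthogonal to `φu` (`riemann_apply_end`). Hence the form is horizontal, independent of `δ`, and
pairs horizontal with vertical arguments only (`identityForm_fst_and_deltaU`).

The splitting is orthogonal, so the horizontal projection is self-adjoint and the trace of such a
form is zero (`metricTrace_adjoint`). If `R(a, b)c ≠ 0`, then at `u = c` the form on the vertical
lift of `R(a, b)c` and the horizontal lift of `b` has product `¼ |R(a, b)c|²` with `a`. -/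

namespace BergerSasaki

/-! ### Levi-Civita calculus of a metric in coordinates. -/

section Metric

variable {F : Type*} [NormedAddCommGroup F] [NormedSpace ℝ F]

/-- `christoffel` uses `ContinuousLinearMap.inverse`, which is zero by default on non-invertible
maps. Positivity gives injectivity, and finite dimension turns this into invertibility. -/
theorem isInvertible_of_pos [FiniteDimensional ℝ F] {B : F →L[ℝ] F →L[ℝ] ℝ}
    (hB : ∀ v, v ≠ 0 → 0 < B v v) : B.IsInvertible := by
  have hinj : Function.Injective B.toLinearMap := by
    rw [injective_iff_map_eq_zero]
    intro v hv
    by_contra hne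
    have h := hB v hne
    have hv' : B v = 0 := hv
    simp [hv'] at h
  have hdim : Module.finrank ℝ F = Module.finrank ℝ (F →L[ℝ] ℝ) := by
    rw [← LinearMap.toContinuousLinearMap.finrank_eq, Subspace.dual_finrank_eq]
  exact ⟨(LinearEquiv.ofInjectiveOfFinrankEq B.toLinearMap hinj hdim).toContinuousLinearEquiv,
    by ext; rfl⟩

theorem eq_of_forall_apply_eq {B : F →L[ℝ] F →L[ℝ] ℝ} (hB : ∀ v, v ≠ 0 → 0 < B v v) {v w : F}
    (h : ∀ c, B v c = B w c) : v = w := by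
  by_contra hne
  have h1 := hB (v - w) (sub_ne_zero.mpr hne)
  simp [h] at h1

theorem apply_christoffel {G : F → F →L[ℝ] F →L[ℝ] ℝ} {x : F} (hG : (G x).IsInvertible)
    (a b c : F) :
    G x (christoffel G x a b) c =
      (1 / 2 : ℝ) * (fderiv ℝ G x a b c + fderiv ℝ G x b a c - fderiv ℝ G x c a b) := by
  rw [christoffel_apply, hG.self_apply_inverse, christoffelFirst_apply]

theorem fderiv_apply_apply {G : F → F →L[ℝ] F →L[ℝ] ℝ} {x : F} (hG : DifferentiableAt ℝ G x)
    {Y Z : F → F} (hY : DifferentiableAt ℝ Y x) (hZ : DifferentiableAt ℝ Z x) (v : F) :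
    fderiv ℝ (fun w ↦ G w (Y w) (Z w)) x v =
      fderiv ℝ G x v (Y x) (Z x) + G x (fderiv ℝ Y x v) (Z x) + G x (Y x) (fderiv ℝ Z x v) := by
  rw [((hG.hasFDerivAt.clm_apply hY.hasFDerivAt).clm_apply hZ.hasFDerivAt).fderiv]
  simp
  ring

theorem fderiv_symm {G : F → F →L[ℝ] F →L[ℝ] ℝ} {x : F} (hG : DifferentiableAt ℝ G x)
    (hs : ∀ᶠ y in nhds x, ∀ a b, G y a b = G y b a) (v a b : F) :
    fderiv ℝ G x v a b = fderiv ℝ G x v b a := by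
  have h : (fun y ↦ G y a b) =ᶠ[nhds x] fun y ↦ G y b a := hs.mono fun y hy ↦ hy a b
  have h1 := h.fderiv_eq (𝕜 := ℝ)
  have e := fun a b : F ↦ fderiv_apply_apply hG (Y := fun _ ↦ a) (Z := fun _ ↦ b)
    (differentiableAt_const a) (differentiableAt_const b) v
  simp only [fderiv_fun_const, Pi.zero_apply, zero_apply, map_zero,
    add_zero] at e
  rw [← e, ← e, h1]

theorem christoffel_symm {G : F → F →L[ℝ] F →L[ℝ] ℝ} {x : F} (hG : DifferentiableAt ℝ G x)
    (hs : ∀ᶠ y in nhds x, ∀ a b, G y a b = G y b a) (a b : F) :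
    christoffel G x a b = christoffel G x b a := by
  rw [christoffel_apply, christoffel_apply]
  congr 1
  ext c
  rw [christoffelFirst_apply, christoffelFirst_apply, fderiv_symm hG hs c a b]
  ring

/-- This is `∇G = 0`: in the sum of the two first-kind symbols, the derivatives other than `∂_c
G_{ab}` cancel by symmetry of `G`. -/
theorem fderiv_eq_christoffel {G : F → F →L[ℝ] F →L[ℝ] ℝ} {x : F} (hG : DifferentiableAt ℝ G x)
    (hi : (G x).IsInvertible) (hs : ∀ᶠ y in nhds x, ∀ a b, G y a b = G y b a) (c a b : F) :
    fderiv ℝ G x c a b = G x (christoffel G x c a) b + G x a (christoffel G x c b) := by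
  rw [hs.self_of_nhds a, apply_christoffel hi, apply_christoffel hi, fderiv_symm hG hs c b a,
    fderiv_symm hG hs b c a, fderiv_symm hG hs a c b]
  ring

theorem contDiffAt_fderiv {F' : Type*} [NormedAddCommGroup F'] [NormedSpace ℝ F'] {f : F → F'}
    {x : F} (hf : ContDiffAt ℝ ∞ f x) : ContDiffAt ℝ ∞ (fderiv ℝ f) x :=
  hf.fderiv_right (m := ∞) (by simp)

theorem contDiffAt_christoffel [CompleteSpace F] {G : F → F →L[ℝ] F →L[ℝ] ℝ} {x : F}
    (hG : ContDiffAt ℝ ∞ G x) (hi : (G x).IsInvertible) : ContDiffAt ℝ ∞ (christoffel G) x := by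
  have h1 := contDiffAt_fderiv hG
  have hf := (ContinuousLinearMap.flipₗᵢ ℝ F F (F →L[ℝ] ℝ)).contDiff.contDiffAt.comp x h1
  have h2 : ContDiffAt ℝ ∞ (christoffelFirst G) x := by
    unfold christoffelFirst derivLast
    exact ((h1.add hf).sub (contDiffAt_const.clm_comp hf)).const_smul (1 / 2 : ℝ)
  have h3 : ContDiffAt ℝ ∞ (fun y ↦ (G y).inverse) x :=
    hi.contDiffAt_map_inverse.comp x hG
  exact ((ContinuousLinearMap.compL ℝ F (F →L[ℝ] ℝ) F).contDiff.contDiffAt.comp x h3).clm_comp h2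

/-- The Koszul formula. -/
theorem koszul {G : F → F →L[ℝ] F →L[ℝ] ℝ} {x : F} (hG : DifferentiableAt ℝ G x)
    (hi : (G x).IsInvertible) (hs : ∀ᶠ y in nhds x, ∀ a b, G y a b = G y b a)
    {X Y Z : F → F} (hX : DifferentiableAt ℝ X x) (hY : DifferentiableAt ℝ Y x)
    (hZ : DifferentiableAt ℝ Z x) :
    2 * G x (leviCivita G X Y x) (Z x) =
      fderiv ℝ (fun w ↦ G w (Y w) (Z w)) x (X x) + fderiv ℝ (fun w ↦ G w (X w) (Z w)) x (Y x) -
      fderiv ℝ (fun w ↦ G w (X w) (Y w)) x (Z x) + G x (VectorField.lieBracket ℝ X Y x) (Z x) -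
      G x (VectorField.lieBracket ℝ X Z x) (Y x) - G x (VectorField.lieBracket ℝ Y Z x) (X x) := by
  have s := hs.self_of_nhds
  rw [fderiv_apply_apply hG hY hZ, fderiv_apply_apply hG hX hZ, fderiv_apply_apply hG hX hY]
  simp only [leviCivita, covDeriv, VectorField.lieBracket, map_add, map_sub,
    add_apply, sub_apply, apply_christoffel hi]
  rw [s (Y x) (fderiv ℝ Z x (X x)), s (X x) (fderiv ℝ Z x (Y x)), s (X x) (fderiv ℝ Y x (Z x))]
  ring

/-- Constant fields commute, so only the classical `∂Γ - ∂Γ + ΓΓ - ΓΓ` remains. This form makes the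
linearity of `riemann` in each slot visible. -/
theorem riemann_eq {G : F → F →L[ℝ] F →L[ℝ] ℝ} {x : F}
    (hΓ : DifferentiableAt ℝ (christoffel G) x) (a b c : F) :
    riemann G x a b c = fderiv ℝ (christoffel G) x a b c - fderiv ℝ (christoffel G) x b a c +
      christoffel G x a (christoffel G x b c) - christoffel G x b (christoffel G x a c) := by
  have e : ∀ a b : F, fderiv ℝ (fun y ↦ christoffel G y b c) x a =
      fderiv ℝ (christoffel G) x a b c := by
    intro a b
    rw [((hΓ.hasFDerivAt.clm_apply (hasFDerivAt_const b x)).clm_apply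
      (hasFDerivAt_const c x)).fderiv]
    simp
  have h : ∀ b c : F, covDeriv (christoffel G) (fun _ ↦ b) (fun _ ↦ c) =
      fun y ↦ christoffel G y b c := fun b c ↦ by ext; simp [covDeriv]
  simp only [riemann, curvature, leviCivita, h]
  simp only [covDeriv, VectorField.lieBracket, fderiv_fun_const,
    Pi.zero_apply, zero_apply, zero_add, sub_zero, map_zero, e]
  abel

end Metric

end BergerSasaki

namespace BergerSasaki

/-! ### The Berger type metric near a point: positivity, smoothness, brackets of lifts, parallelism.
-/

section LocalStructure

variable {E : Type*} [NormedAddCommGroup E] [NormedSpace ℝ E]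

/-- The local expression of an anti-paraKähler structure on the open set `U`. -/
structure IsLocalAntiParaKahler (U : Set E) (g : E → E →L[ℝ] E →L[ℝ] ℝ) (φ : E → E →L[ℝ] E) :
    Prop where
  isOpen : IsOpen U
  metric_smooth : ContDiffOn ℝ ∞ g U
  end_smooth : ContDiffOn ℝ ∞ φ U
  symm : ∀ x ∈ U, ∀ a b, g x a b = g x b a
  pos : ∀ x ∈ U, ∀ a, a ≠ 0 → 0 < g x a a
  selfAdjoint : ∀ x ∈ U, ∀ a b, g x (φ x a) b = g x a (φ x b)
  parallel : ∀ x ∈ U, ∀ a b,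
    fderiv ℝ φ x a b = φ x (christoffel g x a b) - christoffel g x a (φ x b)

/-- The restriction of the Berger type deformed Sasaki metric to vertical lifts. -/
noncomputable def vertMetric (δ : ℝ) (g : E → E →L[ℝ] E →L[ℝ] ℝ) (φ : E → E →L[ℝ] E) (z : E × E) (a b : E) : ℝ :=
  g z.1 a b + δ ^ 2 * g z.1 a (φ z.1 z.2) * g z.1 b (φ z.1 z.2)

theorem bergerSasaki_apply (δ : ℝ) (g : E → E →L[ℝ] E →L[ℝ] ℝ) (φ : E → E →L[ℝ] E)
    (z ξ η : E × E) :
    bergerSasaki δ g φ z ξ η =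
      g z.1 ξ.1 η.1 + vertMetric δ g φ z (deltaU g z ξ) (deltaU g z η) := by
  simp [bergerSasaki, vertMetric]
  ring

theorem deltaU_apply (g : E → E →L[ℝ] E →L[ℝ] ℝ) (z ξ : E × E) :
    deltaU g z ξ = ξ.2 + christoffel g z.1 ξ.1 z.2 := by
  simp [deltaU]

theorem deltaU_hLift (g : E → E →L[ℝ] E →L[ℝ] ℝ) (z : E × E) (a : E) :
    deltaU g z (hLift g z a) = 0 := by
  simp [deltaU, hLift]

theorem deltaU_vLift (g : E → E →L[ℝ] E →L[ℝ] ℝ) (z : E × E) (a : E) :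
    deltaU g z (vLift a) = a := by
  simp [deltaU, vLift]

theorem eq_hLift_add_vLift (g : E → E →L[ℝ] E →L[ℝ] ℝ) (z ξ : E × E) :
    ξ = hLift g z ξ.1 + vLift (deltaU g z ξ) :=
  (hProj_add_vProj g z ξ).symm

theorem bergerSasaki_vLift_right (δ : ℝ) (g : E → E →L[ℝ] E →L[ℝ] ℝ) (φ : E → E →L[ℝ] E)
    (z ξ : E × E) (c : E) :
    bergerSasaki δ g φ z ξ (vLift c) = vertMetric δ g φ z (deltaU g z ξ) c := by
  rw [bergerSasaki_apply, deltaU_vLift]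
  simp [vLift]

theorem bergerSasaki_hLift_right (δ : ℝ) (g : E → E →L[ℝ] E →L[ℝ] ℝ) (φ : E → E →L[ℝ] E)
    (z ξ : E × E) (c : E) :
    bergerSasaki δ g φ z ξ (hLift g z c) = g z.1 ξ.1 c := by
  rw [bergerSasaki_apply, deltaU_hLift]
  simp [hLift, vertMetric]

namespace IsLocalAntiParaKahler

variable {U : Set E} {g : E → E →L[ℝ] E →L[ℝ] ℝ} {φ : E → E →L[ℝ] E}

section
variable (h : IsLocalAntiParaKahler U g φ) {x : E} (hx : x ∈ U)
include h hx

theorem mem_nhds : U ∈ nhds x := h.isOpen.mem_nhds hx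

theorem contDiffAt_metric : ContDiffAt ℝ ∞ g x := h.metric_smooth.contDiffAt (h.mem_nhds hx)

theorem contDiffAt_end : ContDiffAt ℝ ∞ φ x := h.end_smooth.contDiffAt (h.mem_nhds hx)

theorem eventually_symm : ∀ᶠ y in nhds x, ∀ a b, g y a b = g y b a :=
  Filter.mem_of_superset (h.mem_nhds hx) h.symm

theorem differentiableAt_metric : DifferentiableAt ℝ g x :=
  (h.contDiffAt_metric hx).differentiableAt (by simp)

theorem differentiableAt_end : DifferentiableAt ℝ φ x :=
  (h.contDiffAt_end hx).differentiableAt (by simp)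

variable [FiniteDimensional ℝ E]

theorem isInvertible : (g x).IsInvertible := isInvertible_of_pos (h.pos x hx)

theorem contDiffAt_christoffel : ContDiffAt ℝ ∞ (christoffel g) x :=
  have := FiniteDimensional.complete ℝ E
  BergerSasaki.contDiffAt_christoffel (h.contDiffAt_metric hx) (h.isInvertible hx)

theorem differentiableAt_christoffel : DifferentiableAt ℝ (christoffel g) x :=
  (h.contDiffAt_christoffel hx).differentiableAt (by simp)

omit [FiniteDimensional ℝ E] in
theorem christoffel_symm (a b : E) : christoffel g x a b = christoffel g x b a :=
  BergerSasaki.christoffel_symm (h.differentiableAt_metric hx) (h.eventually_symm hx) a b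

theorem fderiv_metric (c a b : E) :
    fderiv ℝ g x c a b = g x (christoffel g x c a) b + g x a (christoffel g x c b) :=
  fderiv_eq_christoffel (h.differentiableAt_metric hx) (h.isInvertible hx)
    (h.eventually_symm hx) c a b

end

section
variable (h : IsLocalAntiParaKahler U g φ) {z : E × E} (hz : z.1 ∈ U)
include h hz

theorem vertMetric_symm (δ : ℝ) (a b : E) : vertMetric δ g φ z a b = vertMetric δ g φ z b a := by
  rw [vertMetric, vertMetric, h.symm _ hz a b]
  ring

theorem vertMetric_pos (δ : ℝ) {a : E} (ha : a ≠ 0) : 0 < vertMetric δ g φ z a a := by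
  have := h.pos _ hz a ha
  have h2 : 0 ≤ (δ * g z.1 a (φ z.1 z.2)) ^ 2 := sq_nonneg _
  rw [vertMetric]
  linarith

theorem bergerSasaki_symm (δ : ℝ) (ξ η : E × E) :
    bergerSasaki δ g φ z ξ η = bergerSasaki δ g φ z η ξ := by
  rw [bergerSasaki_apply, bergerSasaki_apply, h.symm _ hz ξ.1, h.vertMetric_symm hz]

theorem bergerSasaki_pos (δ : ℝ) {ξ : E × E} (hξ : ξ ≠ 0) : 0 < bergerSasaki δ g φ z ξ ξ := by
  rw [bergerSasaki_apply]
  have h0 : vertMetric δ g φ z 0 0 = 0 := by simp [vertMetric]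
  by_cases h1 : ξ.1 = 0
  · have h2 : deltaU g z ξ ≠ 0 := by
      rw [deltaU_apply, h1]
      simp only [map_zero, zero_apply, add_zero]
      exact fun h2 ↦ hξ (Prod.ext h1 h2)
    simpa [h1] using h.vertMetric_pos hz δ h2
  · have h3 := h.pos _ hz _ h1
    by_cases h2 : deltaU g z ξ = 0
    · rw [h2, h0]
      linarith
    · have := h.vertMetric_pos hz δ h2
      linarith

theorem eventually_mem_base : ∀ᶠ w : E × E in nhds z, w.1 ∈ U :=
  continuous_fst.continuousAt.eventually (h.mem_nhds hz)

theorem bergerSasaki_eventually_symm (δ : ℝ) : ∀ᶠ w in nhds z, ∀ ξ η,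
    bergerSasaki δ g φ w ξ η = bergerSasaki δ g φ w η ξ :=
  (h.eventually_mem_base hz).mono fun _ hw ↦ h.bergerSasaki_symm hw δ

variable [FiniteDimensional ℝ E]

theorem bergerSasaki_isInvertible (δ : ℝ) : (bergerSasaki δ g φ z).IsInvertible :=
  isInvertible_of_pos fun _ ↦ h.bergerSasaki_pos hz δ

theorem differentiableAt_bergerSasaki (δ : ℝ) : DifferentiableAt ℝ (bergerSasaki δ g φ) z := by
  have hgs : ContDiffOn ℝ ∞ (fun w : E × E ↦ g w.1) (Prod.fst ⁻¹' U) :=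
    h.metric_smooth.comp contDiff_fst.contDiffOn fun _ hw ↦ hw
  have hΓs : ContDiffOn ℝ ∞ (fun w : E × E ↦ christoffel g w.1) (Prod.fst ⁻¹' U) := fun w hw ↦
    ((h.contDiffAt_christoffel hw).comp w contDiff_fst.contDiffAt).contDiffWithinAt
  have hφs : ContDiffOn ℝ ∞ (fun w : E × E ↦ φ w.1) (Prod.fst ⁻¹' U) :=
    h.end_smooth.comp contDiff_fst.contDiffOn fun _ hw ↦ hw
  have hsnd : ContDiffOn ℝ ∞ (fun w : E × E ↦ w.2) (Prod.fst ⁻¹' U) := contDiff_snd.contDiffOn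
  have hφu := hφs.clm_apply hsnd
  have hδ : ∀ ξ : E × E, ContDiffOn ℝ ∞ (fun w ↦ deltaU g w ξ) (Prod.fst ⁻¹' U) := by
    intro ξ
    simp only [deltaU_apply]
    exact contDiffOn_const.add ((hΓs.clm_apply contDiffOn_const).clm_apply hsnd)
  have hs : ContDiffOn ℝ ∞ (bergerSasaki δ g φ) (Prod.fst ⁻¹' U) := by
    -- In finite dimension, smoothness of a map into linear maps can be tested on each fixed vector.
    rw [contDiffOn_clm_apply]
    intro ξ
    rw [contDiffOn_clm_apply]
    intro η
    simp only [bergerSasaki_apply, vertMetric]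
    exact ((hgs.clm_apply contDiffOn_const).clm_apply contDiffOn_const).add
      (((hgs.clm_apply (hδ ξ)).clm_apply (hδ η)).add
      ((contDiffOn_const.mul ((hgs.clm_apply (hδ ξ)).clm_apply hφu)).mul
        ((hgs.clm_apply (hδ η)).clm_apply hφu)))
  exact (hs.contDiffAt (h.eventually_mem_base hz)).differentiableAt (by simp)

theorem hasFDerivAt_hLift (a : E) : HasFDerivAt (fun w ↦ hLift g w a)
    ((0 : E × E →L[ℝ] E).prod (-((((fderiv ℝ (christoffel g) z.1).flip a).flip z.2) ∘L
      ContinuousLinearMap.fst ℝ E E + christoffel g z.1 a ∘L ContinuousLinearMap.snd ℝ E E))) z := by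
  have h1 : HasFDerivAt (fun w : E × E ↦ christoffel g w.1)
      (fderiv ℝ (christoffel g) z.1 ∘L ContinuousLinearMap.fst ℝ E E) z :=
    (h.differentiableAt_christoffel hz).hasFDerivAt.comp z hasFDerivAt_fst
  have h2 := ((h1.clm_apply (hasFDerivAt_const a z)).clm_apply hasFDerivAt_snd).neg
  refine ((hasFDerivAt_const a z).prodMk h2).congr_fderiv ?_
  ext <;> simp

theorem differentiableAt_hLift (a : E) : DifferentiableAt ℝ (fun w ↦ hLift g w a) z :=
  (h.hasFDerivAt_hLift hz a).differentiableAt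

theorem fderiv_hLift (a : E) (ξ : E × E) : fderiv ℝ (fun w ↦ hLift g w a) z ξ =
    vLift (-(fderiv ℝ (christoffel g) z.1 ξ.1 a z.2 + christoffel g z.1 a ξ.2)) := by
  rw [(h.hasFDerivAt_hLift hz a).fderiv]
  simp [vLift]

theorem lieBracket_hLift_vLift (a b : E) :
    VectorField.lieBracket ℝ (fun w ↦ hLift g w a) (fun _ ↦ vLift b) z =
      vLift (christoffel g z.1 a b) := by
  rw [VectorField.lieBracket, h.fderiv_hLift hz]
  simp [vLift]

theorem lieBracket_vLift_hLift (a b : E) :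
    VectorField.lieBracket ℝ (fun _ ↦ vLift b) (fun w ↦ hLift g w a) z =
      vLift (-christoffel g z.1 a b) := by
  rw [VectorField.lieBracket, h.fderiv_hLift hz]
  simp [vLift]

/-- The curvature is the obstruction to integrability of the horizontal distribution; every
curvature term below enters through this bracket. -/
theorem lieBracket_hLift_hLift (a b : E) :
    VectorField.lieBracket ℝ (fun w ↦ hLift g w a) (fun w ↦ hLift g w b) z =
      vLift (-riemann g z.1 a b z.2) := by
  rw [VectorField.lieBracket, h.fderiv_hLift hz, h.fderiv_hLift hz,
    riemann_eq (h.differentiableAt_christoffel hz)]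
  simp only [hLift, vLift, Prod.mk_sub_mk, sub_zero, map_neg]
  congr 1
  abel

omit [FiniteDimensional ℝ E] in
theorem fderiv_base_vLift (a b q : E) :
    fderiv ℝ (fun w : E × E ↦ g w.1 a b) z (vLift q) = 0 := by
  have h1 : HasFDerivAt (fun w : E × E ↦ g w.1)
      (fderiv ℝ g z.1 ∘L ContinuousLinearMap.fst ℝ E E) z :=
    (h.differentiableAt_metric hz).hasFDerivAt.comp z hasFDerivAt_fst
  rw [((h1.clm_apply (hasFDerivAt_const a z)).clm_apply (hasFDerivAt_const b z)).fderiv]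
  simp [vLift]

omit [FiniteDimensional ℝ E] in
theorem hasFDerivAt_end_apply : HasFDerivAt (fun w : E × E ↦ φ w.1 w.2)
    ((φ z.1) ∘L ContinuousLinearMap.snd ℝ E E +
      (fderiv ℝ φ z.1 ∘L ContinuousLinearMap.fst ℝ E E).flip z.2) z := by
  have h1 : HasFDerivAt (fun w : E × E ↦ φ w.1)
      (fderiv ℝ φ z.1 ∘L ContinuousLinearMap.fst ℝ E E) z :=
    (h.differentiableAt_end hz).hasFDerivAt.comp z hasFDerivAt_fst
  exact h1.clm_apply hasFDerivAt_snd

omit [FiniteDimensional ℝ E] in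
-- Along a horizontal lift `u` is parallel, and `φ` is parallel by hypothesis. So `φu` is parallel
-- too: its derivative is cancelled by its Christoffel term.
theorem fderiv_end_apply_hLift (c : E) : fderiv ℝ (fun w : E × E ↦ φ w.1 w.2) z (hLift g z c) =
    -christoffel g z.1 c (φ z.1 z.2) := by
  rw [(h.hasFDerivAt_end_apply hz).fderiv]
  simp [hLift, h.parallel _ hz]
  abel

/-- The product rule for `∇`: each derivative of `Y`, `Z` combines with a Christoffel term from `∇g
= 0` into a covariant derivative. -/
theorem fderiv_metric_apply {Y Z : E × E → E} (hY : DifferentiableAt ℝ Y z)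
    (hZ : DifferentiableAt ℝ Z z) (c : E) :
    fderiv ℝ (fun w : E × E ↦ g w.1 (Y w) (Z w)) z (hLift g z c) =
      g z.1 (fderiv ℝ Y z (hLift g z c) + christoffel g z.1 c (Y z)) (Z z) +
      g z.1 (Y z) (fderiv ℝ Z z (hLift g z c) + christoffel g z.1 c (Z z)) := by
  have h1 : HasFDerivAt (fun w : E × E ↦ g w.1)
      (fderiv ℝ g z.1 ∘L ContinuousLinearMap.fst ℝ E E) z :=
    (h.differentiableAt_metric hz).hasFDerivAt.comp z hasFDerivAt_fst
  rw [((h1.clm_apply hY.hasFDerivAt).clm_apply hZ.hasFDerivAt).fderiv]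
  simp [hLift, h.fderiv_metric hz]
  ring

omit [FiniteDimensional ℝ E] in
theorem differentiableAt_metric_apply {Y Z : E × E → E} (hY : DifferentiableAt ℝ Y z)
    (hZ : DifferentiableAt ℝ Z z) :
    DifferentiableAt ℝ (fun w : E × E ↦ g w.1 (Y w) (Z w)) z := by
  have h1 : HasFDerivAt (fun w : E × E ↦ g w.1)
      (fderiv ℝ g z.1 ∘L ContinuousLinearMap.fst ℝ E E) z :=
    (h.differentiableAt_metric hz).hasFDerivAt.comp z hasFDerivAt_fst
  exact ((h1.clm_apply hY.hasFDerivAt).clm_apply hZ.hasFDerivAt).differentiableAt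

/-- The vertical metric is built from `g` and `φu`, both parallel along horizontal lifts. This
cancels the vertical-vertical-horizontal terms in the Koszul formula. -/
theorem fderiv_vertMetric_hLift (δ : ℝ) (a b c : E) :
    fderiv ℝ (fun w ↦ vertMetric δ g φ w a b) z (hLift g z c) =
      vertMetric δ g φ z (christoffel g z.1 c a) b +
        vertMetric δ g φ z a (christoffel g z.1 c b) := by
  have hu := (h.hasFDerivAt_end_apply hz).differentiableAt
  have da := differentiableAt_const (𝕜 := ℝ) (x := z) a
  have db := differentiableAt_const (𝕜 := ℝ) (x := z) b
  have d1 := h.differentiableAt_metric_apply hz da db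
  have d2 := h.differentiableAt_metric_apply hz da hu
  have d3 := h.differentiableAt_metric_apply hz db hu
  simp only [vertMetric]
  rw [(d1.hasFDerivAt.fun_add ((d2.hasFDerivAt.const_mul (δ ^ 2)).fun_mul d3.hasFDerivAt)).fderiv]
  simp only [add_apply, smul_apply, smul_eq_mul, h.fderiv_metric_apply hz da db,
    h.fderiv_metric_apply hz da hu, h.fderiv_metric_apply hz db hu, h.fderiv_end_apply_hLift hz]
  simp
  ring

/-- `R(a, b) u` is orthogonal to `φ u`. -/
theorem riemann_apply_end (a b : E) : g z.1 (riemann g z.1 a b z.2) (φ z.1 z.2) = 0 := by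
  -- The function `g(u, φu)` is constant along horizontal lifts, hence also annihilated by their
  -- brackets, which are vertical lifts of `-R(a, b)u`.
  set f : E × E → ℝ := fun w ↦ g w.1 w.2 (φ w.1 w.2) with hf
  have hfs : ContDiffAt ℝ ∞ f z := by
    have h1 := (h.contDiffAt_metric hz).comp z contDiff_fst.contDiffAt
    have h2 := (h.contDiffAt_end hz).comp z contDiff_fst.contDiffAt
    exact (h1.clm_apply contDiff_snd.contDiffAt).clm_apply
      (h2.clm_apply contDiff_snd.contDiffAt)
  have hpar : ∀ c, ∀ᶠ w in nhds z, fderiv ℝ f w (hLift g w c) = 0 := by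
    intro c
    filter_upwards [h.eventually_mem_base hz] with w hw
    rw [h.fderiv_metric_apply hw differentiableAt_snd
      (h.hasFDerivAt_end_apply hw).differentiableAt, h.fderiv_end_apply_hLift hw, fderiv_snd]
    simp [hLift]
  have hdf : DifferentiableAt ℝ (fderiv ℝ f) z :=
    (contDiffAt_fderiv hfs).differentiableAt (by simp)
  have key : ∀ c ξ, fderiv ℝ (fderiv ℝ f) z ξ (hLift g z c) +
      fderiv ℝ f z (fderiv ℝ (fun w ↦ hLift g w c) z ξ) = 0 := by
    intro c ξ
    have h0 : (fun w ↦ fderiv ℝ f w (hLift g w c)) =ᶠ[nhds z] fun _ ↦ 0 := hpar c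
    have h1 := h0.fderiv_eq (𝕜 := ℝ)
    rw [(hdf.hasFDerivAt.clm_apply (h.differentiableAt_hLift hz c).hasFDerivAt).fderiv] at h1
    have h2 := congrArg (fun L : E × E →L[ℝ] ℝ ↦ L ξ) h1
    simp at h2
    linarith
  -- With the second derivative symmetric, subtracting the two instances of `key` leaves only the
  -- derivative along the bracket.
  have hsymm := ((contDiffAt_infty.mp hfs 2).isSymmSndFDerivAt (by simp)).eq (hLift g z a) (hLift g z b)
  have hbr : fderiv ℝ f z
      (VectorField.lieBracket ℝ (fun w ↦ hLift g w a) (fun w ↦ hLift g w b) z) = 0 := by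
    rw [VectorField.lieBracket, map_sub]
    linarith [key b (hLift g z a), key a (hLift g z b)]
  rw [h.lieBracket_hLift_hLift hz] at hbr
  have h1 : HasFDerivAt (fun w : E × E ↦ g w.1)
      (fderiv ℝ g z.1 ∘L ContinuousLinearMap.fst ℝ E E) z :=
    (h.differentiableAt_metric hz).hasFDerivAt.comp z hasFDerivAt_fst
  rw [hf, ((h1.clm_apply hasFDerivAt_snd).clm_apply (h.hasFDerivAt_end_apply hz)).fderiv] at hbr
  simp [vLift] at hbr
  -- Since `φ` is self-adjoint, the derivative of `g(u, φu)` along a vertical lift of `w` is `2 g(w,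
  -- φu)`.
  rw [← h.selfAdjoint _ hz, h.symm _ hz] at hbr
  linarith

theorem vertMetric_riemann (δ : ℝ) (a b q : E) :
    vertMetric δ g φ z (riemann g z.1 a b z.2) q = g z.1 (riemann g z.1 a b z.2) q := by
  simp [vertMetric, h.riemann_apply_end hz]

end

end IsLocalAntiParaKahler

end LocalStructure

end BergerSasaki

namespace BergerSasaki

/-! ### The mixed parts of the Levi-Civita connection and the resulting second fundamental form. -/

section IdentityForm

/-- A connection sees only the value at the point of its first argument, so a constant vector may be
replaced there by a sum of lifts, whose brackets are known. -/
theorem leviCivita_add_left {F : Type*} [NormedAddCommGroup F] [NormedSpace ℝ F]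
    (G : F → F →L[ℝ] F →L[ℝ] ℝ) {X Y Z : F → F} {x v : F} (h : v = X x + Y x) :
    leviCivita G (fun _ ↦ v) Z x = leviCivita G X Z x + leviCivita G Y Z x := by
  simp only [leviCivita, covDeriv, h, map_add, add_apply]
  abel

variable {E : Type*} [NormedAddCommGroup E] [NormedSpace ℝ E]

theorem secondFundamentalForm_id {F : Type*} [NormedAddCommGroup F] [NormedSpace ℝ F]
    (ΓM ΓN : F → F → F → F) (x a b : F) :
    secondFundamentalForm ΓM ΓN id x a b = ΓN x a b - ΓM x a b := by
  simp [secondFundamentalForm]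
  abel

theorem components_meanConnection {F : Type*} [NormedAddCommGroup F] [NormedSpace ℝ F]
    (C : Connection F) (x a b : F) : components (meanConnection C) x a b =
      (1 / 2 : ℝ) • (components C x a b + components C x b a) := by
  simp only [components, meanConnection, torsion, VectorField.lieBracket, fderiv_fun_const,
    Pi.zero_apply, zero_apply, sub_zero]
  module

theorem lieBracket_const {F : Type*} [NormedAddCommGroup F] [NormedSpace ℝ F] (a b x : F) :
    VectorField.lieBracket ℝ (fun _ ↦ a) (fun _ ↦ b) x = 0 := by
  simp [VectorField.lieBracket]

theorem bergerSasaki_vLift_vLift' (δ : ℝ) (g : E → E →L[ℝ] E →L[ℝ] ℝ) (φ : E → E →L[ℝ] E)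
    (z : E × E) (a b : E) :
    bergerSasaki δ g φ z (vLift a) (vLift b) = vertMetric δ g φ z a b :=
  bergerSasaki_vLift_vLift δ g φ z a b

section
variable (δ : ℝ) (g : E → E →L[ℝ] E →L[ℝ] ℝ) (φ : E → E →L[ℝ] E) (z : E × E) (a b c : E)

theorem vertMetric_neg_left : vertMetric δ g φ z (-a) b = -vertMetric δ g φ z a b := by
  simp [vertMetric]
  ring

theorem vertMetric_sub_left :
    vertMetric δ g φ z (a - b) c = vertMetric δ g φ z a c - vertMetric δ g φ z b c := by
  simp [vertMetric]
  ring

theorem vertMetric_smul_left (r : ℝ) :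
    vertMetric δ g φ z (r • a) b = r * vertMetric δ g φ z a b := by
  simp [vertMetric]
  ring

end

namespace IsLocalAntiParaKahler

variable {U : Set E} {g : E → E →L[ℝ] E →L[ℝ] ℝ} {φ : E → E →L[ℝ] E} [FiniteDimensional ℝ E]
  (h : IsLocalAntiParaKahler U g φ) {z : E × E} (hz : z.1 ∈ U)
include h hz

theorem riemann_antisymm (a b c : E) : riemann g z.1 a b c = -riemann g z.1 b a c := by
  rw [riemann_eq (h.differentiableAt_christoffel hz), riemann_eq (h.differentiableAt_christoffel hz)]
  abel

/-- Koszul against a horizontal lift of `c`. For the horizontal part of `ξ` only the bracket of the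
two horizontal lifts contributes; for the vertical part everything cancels by parallelism of the
vertical metric. `vertMetric_riemann` then removes `δ`. -/
theorem inner_leviCivita_vLift (δ : ℝ) (ξ : E × E) (q c : E) :
    g z.1 (leviCivita (bergerSasaki δ g φ) (fun _ ↦ ξ) (fun _ ↦ vLift q) z).1 c =
      (1 / 2 : ℝ) * g z.1 (riemann g z.1 ξ.1 c z.2) q := by
  have hd := h.differentiableAt_bergerSasaki hz δ
  have hi := h.bergerSasaki_isInvertible hz δ
  have hs := h.bergerSasaki_eventually_symm hz δ
  have hX := h.differentiableAt_hLift hz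
  have hV : ∀ b : E, DifferentiableAt ℝ (fun _ : E × E ↦ (vLift b : E × E)) z :=
    fun b ↦ differentiableAt_const _
  have k1 := koszul hd hi hs (hX ξ.1) (hV q) (hX c)
  have k2 := koszul hd hi hs (hV (deltaU g z ξ)) (hV q) (hX c)
  rw [leviCivita_add_left _ (X := fun w ↦ hLift g w ξ.1) (Y := fun _ ↦ vLift (deltaU g z ξ))
    (eq_hLift_add_vLift g z ξ), ← bergerSasaki_hLift_right δ g φ, map_add, add_apply]
  simp only [bergerSasaki_hLift_hLift, bergerSasaki_hLift_vLift, bergerSasaki_vLift_hLift,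
    h.lieBracket_hLift_vLift hz, h.lieBracket_vLift_hLift hz, h.lieBracket_hLift_hLift hz,
    lieBracket_const, bergerSasaki_vLift_vLift', h.fderiv_base_vLift hz, vertMetric_neg_left,
    h.fderiv_vertMetric_hLift hz, fderiv_fun_const, Pi.zero_apply, zero_apply, map_zero,
    h.vertMetric_riemann hz] at k1 k2
  rw [h.vertMetric_symm hz δ _ (christoffel g z.1 c q)] at k2
  linarith

/-- Koszul against a vertical lift, with the same cancellation for the vertical part of `ξ`. Here
the vertical metric stands on both sides, so its nondegeneracy suffices. -/
theorem deltaU_leviCivita_hLift (δ : ℝ) (ξ : E × E) (b : E) :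
    deltaU g z (leviCivita (bergerSasaki δ g φ) (fun _ ↦ ξ) (fun w ↦ hLift g w b) z) =
      -(1 / 2 : ℝ) • riemann g z.1 ξ.1 b z.2 := by
  have hd := h.differentiableAt_bergerSasaki hz δ
  have hi := h.bergerSasaki_isInvertible hz δ
  have hs := h.bergerSasaki_eventually_symm hz δ
  have hX := h.differentiableAt_hLift hz
  have hV : ∀ b : E, DifferentiableAt ℝ (fun _ : E × E ↦ (vLift b : E × E)) z :=
    fun b ↦ differentiableAt_const _
  set D := leviCivita (bergerSasaki δ g φ) (fun _ ↦ ξ) (fun w ↦ hLift g w b) z with hD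
  have key : ∀ c, vertMetric δ g φ z (deltaU g z D) c =
      -(1 / 2) * vertMetric δ g φ z (riemann g z.1 ξ.1 b z.2) c := by
    intro c
    have k1 := koszul hd hi hs (hX ξ.1) (hX b) (hV c)
    have k2 := koszul hd hi hs (hV (deltaU g z ξ)) (hX b) (hV c)
    rw [← bergerSasaki_vLift_right, hD,
      leviCivita_add_left _ (X := fun w ↦ hLift g w ξ.1) (Y := fun _ ↦ vLift (deltaU g z ξ))
      (eq_hLift_add_vLift g z ξ), map_add, add_apply]
    simp only [bergerSasaki_hLift_hLift, bergerSasaki_hLift_vLift, bergerSasaki_vLift_hLift,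
      h.lieBracket_hLift_vLift hz, h.lieBracket_vLift_hLift hz, h.lieBracket_hLift_hLift hz,
      lieBracket_const, bergerSasaki_vLift_vLift', h.fderiv_base_vLift hz, vertMetric_neg_left,
      h.fderiv_vertMetric_hLift hz, fderiv_fun_const, Pi.zero_apply, zero_apply, map_zero] at k1 k2
    rw [h.vertMetric_symm hz δ _ (christoffel g z.1 b c)] at k2
    linarith
  -- Testing `key` on the difference of the two sides gives it length zero, against positivity.
  by_contra hne
  have hpos := h.vertMetric_pos hz δ (sub_ne_zero.mpr hne)
  have hk := key (deltaU g z D - -(1 / 2 : ℝ) • riemann g z.1 ξ.1 b z.2)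
  rw [vertMetric_sub_left, hk, neg_smul, vertMetric_neg_left, vertMetric_smul_left] at hpos
  linarith

theorem identityForm_fst_and_deltaU (δ : ℝ) (ξ η : E × E) :
    (∀ c, g z.1 (identityForm δ g φ z ξ η).1 c =
      (1 / 4 : ℝ) * (g z.1 (riemann g z.1 c ξ.1 z.2) (deltaU g z η) +
        g z.1 (riemann g z.1 c η.1 z.2) (deltaU g z ξ))) ∧
    deltaU g z (identityForm δ g φ z ξ η) = 0 := by
  set D := leviCivita (bergerSasaki δ g φ) with hD
  have hδ : ∀ η : E × E, DifferentiableAt ℝ (fun w ↦ deltaU g w η) z := by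
    intro η
    have h1 : DifferentiableAt ℝ (fun w : E × E ↦ christoffel g w.1) z :=
      (h.differentiableAt_christoffel hz).comp z differentiableAt_fst
    simp only [deltaU_apply]
    exact (differentiableAt_const _).add
      ((h1.clm_apply (differentiableAt_const _)).clm_apply differentiableAt_snd)
  have hV : ∀ η : E × E, HasFDerivAt (fun w ↦ vProj g w η)
      ((0 : E × E →L[ℝ] E).prod (fderiv ℝ (fun w ↦ deltaU g w η) z)) z := fun η ↦
    (hasFDerivAt_const (0 : E) z).prodMk (hδ η).hasFDerivAt
  -- the horizontal part of the derivative of a vertical field is tensorial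
  have hA : ∀ ξ η : E × E, (D (fun _ ↦ ξ) (fun w ↦ vProj g w η) z).1 =
      (D (fun _ ↦ ξ) (fun _ ↦ vLift (deltaU g z η)) z).1 := by
    intro ξ η
    simp only [hD, leviCivita, covDeriv]
    rw [(hV η).fderiv]
    simp [vProj]
  have hB : ∀ ξ η : E × E, D (fun _ ↦ ξ) (fun w ↦ hProj g w η) z =
      D (fun _ ↦ ξ) (fun w ↦ hLift g w η.1) z := fun _ _ ↦ rfl
  have hAB : ∀ ξ η : E × E, components D z ξ η = D (fun _ ↦ ξ) (fun w ↦ vProj g w η) z +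
      D (fun _ ↦ ξ) (fun w ↦ hProj g w η) z := by
    intro ξ η
    have e : (fun _ : E × E ↦ η) = fun w ↦ vProj g w η + hProj g w η := by
      ext1 w
      rw [add_comm, hProj_add_vProj]
    rw [components, e]
    simp only [hD, leviCivita, covDeriv, map_add]
    have hH : DifferentiableAt ℝ (fun w ↦ hProj g w η) z := h.differentiableAt_hLift hz η.1
    rw [fderiv_fun_add (hV η).differentiableAt hH, add_apply]
    abel
  have hsymm : components D z ξ η = components D z η ξ := by
    simp only [components, hD, leviCivita, covDeriv, fderiv_fun_const, Pi.zero_apply, zero_apply,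
      zero_add]
    exact BergerSasaki.christoffel_symm (h.differentiableAt_bergerSasaki hz δ)
      (h.bergerSasaki_eventually_symm hz δ) ξ η
  have hid : identityForm δ g φ z ξ η = (1 / 2 : ℝ) • (
      (vProj g z (D (fun _ ↦ ξ) (fun w ↦ vProj g w η) z) +
        hProj g z (D (fun _ ↦ ξ) (fun w ↦ hProj g w η) z)) +
      (vProj g z (D (fun _ ↦ η) (fun w ↦ vProj g w ξ) z) +
        hProj g z (D (fun _ ↦ η) (fun w ↦ hProj g w ξ) z))) - components D z ξ η := by
    rw [identityForm, secondFundamentalForm_id, components_meanConnection]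
    rfl
  set A := D (fun _ ↦ ξ) (fun w ↦ vProj g w η) z
  set B := D (fun _ ↦ ξ) (fun w ↦ hProj g w η) z with hB1
  set A' := D (fun _ ↦ η) (fun w ↦ vProj g w ξ) z
  set B' := D (fun _ ↦ η) (fun w ↦ hProj g w ξ) z with hB2
  -- Torsion-freeness of `D`. It lets the subtracted `A + B` be averaged with `A' + B'`, leaving `-½
  -- (H(A + A') + V(B + B'))`.
  have hAB' : A + B = A' + B' := by rw [← hAB, ← hAB, hsymm]
  rw [hAB] at hid
  change _ = _ - (A + B) at hid
  have hRc : ∀ a b, g z.1 (riemann g z.1 a b z.2) = -g z.1 (riemann g z.1 b a z.2) := by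
    intro a b
    rw [h.riemann_antisymm hz, map_neg]
  constructor
  · intro c
    have h1 : (identityForm δ g φ z ξ η).1 = -(1 / 2 : ℝ) • (A.1 + A'.1) := by
      have h2 : B'.1 = A.1 + B.1 - A'.1 := by
        rw [eq_sub_iff_add_eq, ← Prod.fst_add, add_comm, ← hAB', Prod.fst_add]
      rw [hid]
      simp only [vProj, vLift, hProj, hLift, Prod.fst_add, Prod.fst_sub, Prod.smul_fst, h2]
      module
    rw [h1, hA, hA]
    simp only [map_smul, map_add, smul_apply, add_apply, hD, h.inner_leviCivita_vLift hz,
      smul_eq_mul]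
    rw [hRc c ξ.1, hRc c η.1, neg_apply, neg_apply]
    ring
  · have hdV : ∀ ζ, deltaU g z (vProj g z ζ) = deltaU g z ζ := fun ζ ↦ deltaU_vLift g z _
    have hdH : ∀ ζ, deltaU g z (hProj g z ζ) = 0 := fun ζ ↦ deltaU_hLift g z _
    have h1 : deltaU g z (identityForm δ g φ z ξ η) =
        -(1 / 2 : ℝ) • (deltaU g z B + deltaU g z B') := by
      have h2 : deltaU g z A' = deltaU g z A + deltaU g z B - deltaU g z B' := by
        rw [eq_sub_iff_add_eq, ← map_add, ← hAB', map_add]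
      rw [hid]
      simp only [map_sub, map_smul, map_add, hdV, hdH, h2]
      module
    -- The two vertical contributions are opposite because `R` is skew in its first two arguments.
    rw [h1, hB1, hB2, hB, hB, h.deltaU_leviCivita_hLift hz, h.deltaU_leviCivita_hLift hz,
      h.riemann_antisymm hz η.1]
    module

end IsLocalAntiParaKahler

end IdentityForm

end BergerSasaki

namespace BergerSasaki

/-! ### Traces with respect to a metric in an arbitrary basis. -/

section Trace

open Matrix

variable {F ι : Type*} [NormedAddCommGroup F] [NormedSpace ℝ F] [Fintype ι] [DecidableEq ι]

theorem isUnit_gram (b : Module.Basis ι ℝ F) {B : F →L[ℝ] F →L[ℝ] ℝ}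
    (hB : ∀ v, v ≠ 0 → 0 < B v v) : IsUnit (Matrix.of fun i j ↦ B (b i) (b j)) := by
  rw [← Matrix.mulVec_injective_iff_isUnit]
  rw [← Matrix.coe_mulVecLin, injective_iff_map_eq_zero]
  intro v hv
  have h1 : ∀ i, B (b i) (∑ j, v j • b j) = 0 := by
    intro i
    have := congrFun hv i
    simp only [Matrix.mulVecLin_apply, Matrix.mulVec, dotProduct, Matrix.of_apply,
      Pi.zero_apply] at this
    rw [← this, map_sum]
    exact Finset.sum_congr rfl fun j _ ↦ by rw [map_smul, smul_eq_mul, mul_comm]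
  have hw : ∀ w, (∀ i, B (b i) w = 0) → B (∑ i, v i • b i) w = 0 := by
    intro w hw
    simp [hw]
  have h0 : ∑ i, v i • b i = 0 := by
    by_contra hne
    exact (hB _ hne).ne' (hw _ h1)
  exact funext (Fintype.linearIndependent_iff.mp b.linearIndependent v h0)

/-- With Gram matrix `M` and matrix `h` of `P`, self-adjointness reads `hᵀ M = M h`, hence `M⁻¹ hᵀ =
h M⁻¹`. The two traces contract `β` with these two matrices. -/
theorem metricTrace_adjoint (b : Module.Basis ι ℝ F) {B : F →L[ℝ] F →L[ℝ] ℝ}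
    (hB : ∀ v, v ≠ 0 → 0 < B v v) (β : F →ₗ[ℝ] F →ₗ[ℝ] ℝ) (P : F →ₗ[ℝ] F)
    (hP : ∀ v w, B (P v) w = B v (P w)) :
    metricTrace b B (fun v w ↦ β (P v) w) = metricTrace b B fun v w ↦ β v (P w) := by
  set M := Matrix.of fun i j ↦ B (b i) (b j) with hM
  set h := LinearMap.toMatrix b b P with hh
  have hPb : ∀ A, P (b A) = ∑ C, h C A • b C := by
    intro A
    rw [← b.sum_repr (P (b A))]
    simp [hh, LinearMap.toMatrix_apply]
  have hu : IsUnit M.det := (Matrix.isUnit_iff_isUnit_det M).mp (isUnit_gram b hB)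
  have h1 : hᵀ * M = M * h := by
    ext i j
    have := hP (b i) (b j)
    rw [hPb, hPb] at this
    simp only [map_sum, map_smul, smul_eq_mul, _root_.sum_apply, _root_.smul_apply] at this
    simp only [Matrix.mul_apply, Matrix.transpose_apply, hM, Matrix.of_apply]
    rw [this]
    exact Finset.sum_congr rfl fun _ _ ↦ mul_comm _ _
  have h2 : M⁻¹ * hᵀ = h * M⁻¹ := by
    calc M⁻¹ * hᵀ = M⁻¹ * (hᵀ * M) * M⁻¹ := by
          rw [Matrix.mul_assoc, Matrix.mul_assoc, Matrix.mul_nonsing_inv _ hu, Matrix.mul_one]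
      _ = h * M⁻¹ := by
          rw [h1, ← Matrix.mul_assoc, Matrix.nonsing_inv_mul _ hu, Matrix.one_mul]
  calc metricTrace b B (fun v w ↦ β (P v) w)
      = ∑ C, ∑ D, (h * M⁻¹) C D * β (b C) (b D) := by
        simp only [metricTrace, ← hM, hPb, map_sum, map_smul, LinearMap.sum_apply,
          LinearMap.smul_apply, smul_eq_mul, Matrix.mul_apply, Finset.mul_sum, Finset.sum_mul]
        rw [Finset.sum_comm, Finset.sum_congr rfl fun _ _ ↦ Finset.sum_comm, Finset.sum_comm]
        refine Finset.sum_congr rfl fun C _ ↦ Finset.sum_congr rfl fun D _ ↦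
          Finset.sum_congr rfl fun A _ ↦ ?_
        ring
    _ = ∑ C, ∑ D, (M⁻¹ * hᵀ) C D * β (b C) (b D) := by rw [h2]
    _ = metricTrace b B fun v w ↦ β v (P w) := by
        simp only [metricTrace, ← hM, hPb, map_sum, map_smul, smul_eq_mul, Matrix.mul_apply,
          Matrix.transpose_apply, Finset.mul_sum, Finset.sum_mul]
        refine Finset.sum_congr rfl fun A _ ↦ ?_
        rw [Finset.sum_comm]
        refine Finset.sum_congr rfl fun C _ ↦ Finset.sum_congr rfl fun D _ ↦ ?_
        ring

end Trace

/-! ### Values on the adapted frame and vanishing of the tension field. -/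

section Frames

theorem exists_linearMap_riemann_second {F : Type*} [NormedAddCommGroup F] [NormedSpace ℝ F]
    {G : F → F →L[ℝ] F →L[ℝ] ℝ} {x : F} (hΓ : DifferentiableAt ℝ (christoffel G) x) (a c : F) :
    ∃ L : F →L[ℝ] F, ∀ b, riemann G x a b c = L b :=
  ⟨(fderiv ℝ (christoffel G) x a).flip c - ((fderiv ℝ (christoffel G) x).flip a).flip c +
    christoffel G x a ∘L (christoffel G x).flip c -
    (christoffel G x).flip (christoffel G x a c), fun b ↦ by simp [riemann_eq hΓ]⟩

theorem exists_linearMap_riemann_third {F : Type*} [NormedAddCommGroup F] [NormedSpace ℝ F]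
    {G : F → F →L[ℝ] F →L[ℝ] ℝ} {x : F} (hΓ : DifferentiableAt ℝ (christoffel G) x) (a b : F) :
    ∃ L : F →L[ℝ] F, ∀ c, riemann G x a b c = L c :=
  ⟨fderiv ℝ (christoffel G) x a b - fderiv ℝ (christoffel G) x b a +
    christoffel G x a ∘L christoffel G x b - christoffel G x b ∘L christoffel G x a,
    fun c ↦ by simp [riemann_eq hΓ]⟩

namespace IsLocalAntiParaKahler

section
variable {E : Type*} [NormedAddCommGroup E] [NormedSpace ℝ E] [FiniteDimensional ℝ E]
  {U : Set E} {g : E → E →L[ℝ] E →L[ℝ] ℝ} {φ : E → E →L[ℝ] E}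
  (h : IsLocalAntiParaKahler U g φ) {z : E × E} (hz : z.1 ∈ U)
include h hz

theorem riemann_zero_second (a c : E) : riemann g z.1 a 0 c = 0 := by
  obtain ⟨L, hL⟩ := exists_linearMap_riemann_second (h.differentiableAt_christoffel hz) a c
  rw [hL, map_zero]

omit [FiniteDimensional ℝ E] in
/-- A vector is determined by its vertical part and the products of its base component. -/
theorem eq_of_fst_of_deltaU {ξ η : E × E} (h1 : ∀ c, g z.1 ξ.1 c = g z.1 η.1 c)
    (h2 : deltaU g z ξ = deltaU g z η) : ξ = η := by
  rw [eq_hLift_add_vLift g z ξ, eq_hLift_add_vLift g z η, h2,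
    eq_of_forall_apply_eq (h.pos _ hz) h1]

theorem identityForm_hLift_hLift (δ : ℝ) (a b : E) :
    identityForm δ g φ z (hLift g z a) (hLift g z b) = 0 := by
  obtain ⟨h1, h2⟩ := h.identityForm_fst_and_deltaU hz δ (hLift g z a) (hLift g z b)
  refine h.eq_of_fst_of_deltaU hz (fun c ↦ ?_) (by rw [h2, map_zero])
  rw [h1, deltaU_hLift, deltaU_hLift]
  simp

theorem identityForm_vLift_vLift (δ : ℝ) (a b : E) :
    identityForm δ g φ z (vLift a) (vLift b) = 0 := by
  obtain ⟨h1, h2⟩ := h.identityForm_fst_and_deltaU hz δ (vLift a) (vLift b)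
  refine h.eq_of_fst_of_deltaU hz (fun c ↦ ?_) (by rw [h2, map_zero])
  rw [h1]
  simp [vLift, h.riemann_zero_second hz]

theorem identityForm_vLift_hLift_apply (δ : ℝ) (a b c : E) :
    g z.1 (identityForm δ g φ z (vLift a) (hLift g z b)).1 c =
      (1 / 4 : ℝ) * g z.1 (riemann g z.1 c b z.2) a := by
  rw [(h.identityForm_fst_and_deltaU hz δ _ _).1, deltaU_hLift, deltaU_vLift]
  simp [hLift]

theorem identityForm_comm (δ : ℝ) (ξ η : E × E) :
    identityForm δ g φ z ξ η = identityForm δ g φ z η ξ := by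
  obtain ⟨h1, h2⟩ := h.identityForm_fst_and_deltaU hz δ ξ η
  obtain ⟨h3, h4⟩ := h.identityForm_fst_and_deltaU hz δ η ξ
  refine h.eq_of_fst_of_deltaU hz (fun c ↦ ?_) (by rw [h2, h4])
  rw [h1, h3, add_comm]

/-- The projection onto the horizontal distribution is self-adjoint, and so every bilinear map that
pairs horizontal with vertical parts has trace zero. -/
theorem metricTrace_mixed {ι : Type*} [Fintype ι] [DecidableEq ι]
    (b : Module.Basis ι ℝ (E × E)) (δ : ℝ) (c : E) :
    metricTrace b (bergerSasaki δ g φ z)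
      (fun ξ η ↦ g z.1 (riemann g z.1 c ξ.1 z.2) (deltaU g z η)) = 0 ∧
    metricTrace b (bergerSasaki δ g φ z)
      (fun ξ η ↦ g z.1 (riemann g z.1 c η.1 z.2) (deltaU g z ξ)) = 0 := by
  obtain ⟨L, hL⟩ := exists_linearMap_riemann_second (h.differentiableAt_christoffel hz) c z.2
  let H : E × E →ₗ[ℝ] E × E := (ContinuousLinearMap.prod (ContinuousLinearMap.fst ℝ E E)
    (-((christoffel g z.1).flip z.2 ∘L ContinuousLinearMap.fst ℝ E E))).toLinearMap
  have hH : ∀ ξ, H ξ = hLift g z ξ.1 := fun ξ ↦ by simp [H, hLift]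
  have hadj : ∀ ξ η, bergerSasaki δ g φ z (H ξ) η = bergerSasaki δ g φ z ξ (H η) := by
    intro ξ η
    rw [hH, hH, bergerSasaki_hLift_right, h.bergerSasaki_symm hz, bergerSasaki_hLift_right,
      h.symm _ hz]
  let β : E × E →ₗ[ℝ] E × E →ₗ[ℝ] ℝ := LinearMap.mk₂ ℝ
    (fun ξ η ↦ g z.1 (L ξ.1) (deltaU g z η)) (by simp) (by simp) (by simp) (by simp)
  have hβ : ∀ ξ η, β ξ η = g z.1 (L ξ.1) (deltaU g z η) := fun _ _ ↦ rfl
  have hpos := fun ξ hξ ↦ h.bergerSasaki_pos hz δ (ξ := ξ) hξ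
  have t1 := metricTrace_adjoint b hpos β H hadj
  have t2 := metricTrace_adjoint b hpos β.flip H hadj
  -- `β` is unchanged by projecting its first argument and vanishes when its second is horizontal,
  -- so adjointness equates its trace with zero; `β.flip` handles the other order.
  simp only [LinearMap.flip_apply, hβ, hH, deltaU_hLift, map_zero] at t1 t2
  simp only [hL]
  constructor
  · refine Eq.trans ?_ (t1.trans ?_)
    · rfl
    · simp [metricTrace]
  · refine Eq.trans ?_ (t2.symm.trans ?_)
    · rfl
    · simp [metricTrace]

theorem metricTrace_identityForm {ι : Type*} [Fintype ι] [DecidableEq ι]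
    (b : Module.Basis ι ℝ (E × E)) (δ : ℝ) :
    metricTrace b (bergerSasaki δ g φ z) (identityForm δ g φ z) = 0 := by
  refine h.eq_of_fst_of_deltaU hz (fun c ↦ ?_) ?_
  · obtain ⟨t1, t2⟩ := h.metricTrace_mixed hz b δ c
    simp only [metricTrace, Prod.fst_sum, Prod.smul_fst, map_sum, map_smul, _root_.sum_apply,
      smul_apply, (h.identityForm_fst_and_deltaU hz δ _ _).1, smul_eq_mul] at t1 t2 ⊢
    simp only [mul_add, Finset.sum_add_distrib, mul_left_comm _ (1 / 4 : ℝ), ← Finset.mul_sum,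
      t1, t2]
    simp
  · simp only [metricTrace, map_sum, map_smul, (h.identityForm_fst_and_deltaU hz δ _ _).2]
    simp

end

section
variable {n : ℕ} {U : Set (EuclideanSpace ℝ (Fin n))}
  {g : EuclideanSpace ℝ (Fin n) → EuclideanSpace ℝ (Fin n) →L[ℝ] EuclideanSpace ℝ (Fin n) →L[ℝ] ℝ}
  {φ : EuclideanSpace ℝ (Fin n) → EuclideanSpace ℝ (Fin n) →L[ℝ] EuclideanSpace ℝ (Fin n)}
  (h : IsLocalAntiParaKahler U g φ)
  {z : EuclideanSpace ℝ (Fin n) × EuclideanSpace ℝ (Fin n)} (hz : z.1 ∈ U)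

theorem _root_.BergerSasaki.sum_coordVec (v : EuclideanSpace ℝ (Fin n)) :
    ∑ i, v i • (coordVec i : EuclideanSpace ℝ (Fin n)) = v := by
  ext j
  simp [coordVec, Pi.single_apply]

include h hz

theorem sum_riemannComp (l j i : Fin n) :
    ∑ s, (∑ m, riemannComp g z.1 l j m s * z.2 m) * g z.1 (coordVec s) (coordVec i) =
      g z.1 (riemann g z.1 (coordVec l) (coordVec j) z.2) (coordVec i) := by
  obtain ⟨L, hL⟩ := exists_linearMap_riemann_third (h.differentiableAt_christoffel hz)
    (coordVec l) (coordVec j)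
  have hs : ∀ s, ∑ m, riemannComp g z.1 l j m s * z.2 m = L z.2 s := by
    intro s
    conv_rhs => rw [← sum_coordVec z.2]
    simp [riemannComp, hL, mul_comm]
  rw [hL]
  conv_rhs => rw [← sum_coordVec (L z.2)]
  simp [hs]

theorem identityForm_verFrame_horFrame (δ : ℝ) (i j : Fin n) :
    identityForm δ g φ z (verFrame i) (horFrame g z j) =
      (1 / 4 : ℝ) • ∑ l, raisedCurvature g z l j i • horFrame g z l := by
  refine h.eq_of_fst_of_deltaU hz (fun c ↦ ?_) ?_
  · set M := Matrix.of fun p q : Fin n ↦ g z.1 (coordVec p) (coordVec q) with hM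
    have hu : IsUnit M.det := by
      have := isUnit_gram (EuclideanSpace.basisFun (Fin n) ℝ).toBasis (h.pos _ hz)
      simp only [OrthonormalBasis.coe_toBasis, EuclideanSpace.basisFun_apply] at this
      exact (Matrix.isUnit_iff_isUnit_det M).mp this
    have hr : ∀ q, raisedCurvature g z q j i = ∑ l, M⁻¹ l q *
        g z.1 (riemann g z.1 (coordVec l) (coordVec j) z.2) (coordVec i) := by
      intro q
      simp only [raisedCurvature, ← hM, ← h.sum_riemannComp hz, Finset.mul_sum]
      exact Finset.sum_congr rfl fun _ _ ↦ Finset.sum_congr rfl fun _ _ ↦ by ring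
    -- Lowering the raised index with `g` cancels the inverse matrix in `raisedCurvature`.
    have key : ∀ p, g z.1 (∑ l, raisedCurvature g z l j i • coordVec l) (coordVec p) =
        g z.1 (riemann g z.1 (coordVec p) (coordVec j) z.2) (coordVec i) := by
      intro p
      have hp : ∀ l, ∑ q, M⁻¹ l q * M q p = if l = p then 1 else 0 := by
        intro l
        rw [← Matrix.mul_apply, Matrix.nonsing_inv_mul _ hu, Matrix.one_apply]
      simp only [hr, map_sum, map_smul, _root_.sum_apply, smul_apply, smul_eq_mul, Finset.sum_mul]
      rw [Finset.sum_comm]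
      calc _ = ∑ l, (∑ q, M⁻¹ l q * M q p) *
            g z.1 (riemann g z.1 (coordVec l) (coordVec j) z.2) (coordVec i) := by
            simp only [Finset.sum_mul, hM, Matrix.of_apply]
            exact Finset.sum_congr rfl fun _ _ ↦ Finset.sum_congr rfl fun _ _ ↦ by ring
        _ = _ := by simp [hp]
    -- Skewness moves the free vector into the second slot of `riemann`, where `L` expresses
    -- linearity; both sides are then compared on coordinate vectors.
    obtain ⟨L, hL⟩ := exists_linearMap_riemann_second (h.differentiableAt_christoffel hz)
      (coordVec j) z.2
    rw [verFrame, horFrame, h.identityForm_vLift_hLift_apply hz, h.riemann_antisymm hz, hL]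
    simp only [Prod.smul_fst, Prod.fst_sum, horFrame, hLift, map_smul, smul_apply, smul_eq_mul]
    congr 1
    conv_lhs => rw [← sum_coordVec c]
    conv_rhs => rw [← sum_coordVec c]
    rw [map_sum, map_sum]
    simp only [map_smul, key, h.riemann_antisymm hz _ (coordVec j), hL]
    simp
  · rw [verFrame, horFrame, (h.identityForm_fst_and_deltaU hz δ _ _).2]
    simp [horFrame, deltaU_hLift]

end

end IsLocalAntiParaKahler

end Frames

end BergerSasaki

namespace BergerSasaki

/-! ### From the manifold to a chart. -/

section Chart

variable {E : Type*} [NormedAddCommGroup E] [NormedSpace ℝ E]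
  {M : Type*} [TopologicalSpace M] [ChartedSpace E M] [IsManifold 𝓘(ℝ, E) ∞ M]
  {e : OpenPartialHomeomorph M E}

omit [IsManifold 𝓘(ℝ, E) ∞ M] in
theorem mdifferentiable_of_mem_maximalAtlas (he : e ∈ IsManifold.maximalAtlas 𝓘(ℝ, E) ∞ M) :
    e.MDifferentiable 𝓘(ℝ, E) 𝓘(ℝ, E) :=
  ⟨(contMDiffOn_of_mem_maximalAtlas he).mdifferentiableOn (by simp),
    (contMDiffOn_symm_of_mem_maximalAtlas he).mdifferentiableOn (by simp)⟩

omit [IsManifold 𝓘(ℝ, E) ∞ M] in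
theorem chartDeriv_chartSymmDeriv (he : e ∈ IsManifold.maximalAtlas 𝓘(ℝ, E) ∞ M) {x : E}
    (hx : x ∈ e.target) (a : E) : chartDeriv e (e.symm x) (chartSymmDeriv e x a) = a :=
  congrArg (fun L : E →L[ℝ] E ↦ L a)
    ((mdifferentiable_of_mem_maximalAtlas he).comp_symm_deriv hx)

omit [IsManifold 𝓘(ℝ, E) ∞ M] in
theorem chartSymmDeriv_chartDeriv (he : e ∈ IsManifold.maximalAtlas 𝓘(ℝ, E) ∞ M) {x : E}
    (hx : x ∈ e.target) (v : TangentSpace 𝓘(ℝ, E) (e.symm x)) :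
    chartSymmDeriv e x (chartDeriv e (e.symm x) v) = v := by
  have h := (mdifferentiable_of_mem_maximalAtlas he).symm_comp_deriv (e.map_target hx)
  rw [e.right_inv hx] at h
  exact congrArg (fun L : TangentSpace 𝓘(ℝ, E) (e.symm x) →L[ℝ] TangentSpace 𝓘(ℝ, E) (e.symm x) ↦
    L v) h

/-- The coordinate vector fields are smooth. -/
theorem contMDiffOn_chartSymmDeriv (he : e ∈ IsManifold.maximalAtlas 𝓘(ℝ, E) ∞ M) (a : E) :
    ContMDiffOn 𝓘(ℝ, E) (𝓘(ℝ, E).prod 𝓘(ℝ, E)) ∞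
      (fun x ↦ (TotalSpace.mk' E (E := fun p : M ↦ TangentSpace 𝓘(ℝ, E) p)
        (e.symm x) (chartSymmDeriv e x a))) e.target := by
  have h1 := (contMDiffOn_symm_of_mem_maximalAtlas he).contMDiffOn_tangentMapWithin (m := ∞)
    (by simp) e.open_target.uniqueMDiffOn
  have h2 : ContMDiffOn 𝓘(ℝ, E) (𝓘(ℝ, E).prod 𝓘(ℝ, E)) ∞
      (fun x ↦ (⟨x, a⟩ : TangentBundle 𝓘(ℝ, E) E)) e.target :=
    contMDiffOn_vectorSpace_iff_contDiffOn.2 contDiffOn_const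
  refine (h1.comp h2 fun x hx ↦ hx).congr fun x hx ↦ ?_
  simp only [Function.comp_apply, tangentMapWithin, mfderivWithin_of_isOpen e.open_target hx]
  rfl

theorem contDiffOn_localMetric [FiniteDimensional ℝ E]
    (g : ContMDiffRiemannianMetric 𝓘(ℝ, E) ∞ E (fun p : M ↦ TangentSpace 𝓘(ℝ, E) p))
    (he : e ∈ IsManifold.maximalAtlas 𝓘(ℝ, E) ∞ M) :
    ContDiffOn ℝ ∞ (localMetric g e) e.target := by
  rw [contDiffOn_clm_apply]
  intro a
  rw [contDiffOn_clm_apply]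
  intro b
  rw [← contMDiffOn_iff_contDiffOn]
  have hg := g.contMDiff.comp_contMDiffOn (contMDiffOn_symm_of_mem_maximalAtlas he)
  have h1 := ContMDiffOn.clm_bundle_apply₂ (F₁ := E) (F₂ := E) (F₃ := ℝ)
    (E₃ := Bundle.Trivial M ℝ) (b := e.symm) hg
    (contMDiffOn_chartSymmDeriv he a) (contMDiffOn_chartSymmDeriv he b)
  exact fun x hx ↦ (contMDiffWithinAt_totalSpace.1 (h1 x hx)).2

theorem contDiffOn_localEnd [FiniteDimensional ℝ E]
    {g : ContMDiffRiemannianMetric 𝓘(ℝ, E) ∞ E (fun p : M ↦ TangentSpace 𝓘(ℝ, E) p)}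
    {φ : (p : M) → TangentSpace 𝓘(ℝ, E) p →L[ℝ] TangentSpace 𝓘(ℝ, E) p}
    (hK : IsAntiParaKahler g φ)
    (he : e ∈ IsManifold.maximalAtlas 𝓘(ℝ, E) ∞ M) :
    ContDiffOn ℝ ∞ (localEnd φ e) e.target := by
  rw [contDiffOn_clm_apply]
  intro a
  have hφ := hK.smooth.comp_contMDiffOn (contMDiffOn_symm_of_mem_maximalAtlas he)
  have h1 := ContMDiffOn.clm_bundle_apply (F₁ := E) (F₂ := E) (b := e.symm) hφ
    (contMDiffOn_chartSymmDeriv he a)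
  have h2 := (contMDiffOn_of_mem_maximalAtlas he).contMDiffOn_tangentMapWithin (m := ∞)
    (by simp) e.open_source.uniqueMDiffOn
  have h3 := (contMDiff_snd_tangentBundle_modelSpace (n := ∞) E 𝓘(ℝ, E)).comp_contMDiffOn
    (h2.comp h1 fun x hx ↦ e.map_target hx)
  rw [← contMDiffOn_iff_contDiffOn]
  refine h3.congr fun x hx ↦ ?_
  change localEnd φ e x a = mfderivWithin 𝓘(ℝ, E) 𝓘(ℝ, E) e e.source (e.symm x)
    (φ (e.symm x) (chartSymmDeriv e x a))
  rw [mfderivWithin_of_isOpen e.open_source (e.map_target hx)]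
  rfl

theorem IsAntiParaKahler.isLocalAntiParaKahler [FiniteDimensional ℝ E]
    {g : ContMDiffRiemannianMetric 𝓘(ℝ, E) ∞ E (fun p : M ↦ TangentSpace 𝓘(ℝ, E) p)}
    {φ : (p : M) → TangentSpace 𝓘(ℝ, E) p →L[ℝ] TangentSpace 𝓘(ℝ, E) p}
    (hK : IsAntiParaKahler g φ) (he : e ∈ IsManifold.maximalAtlas 𝓘(ℝ, E) ∞ M) :
    IsLocalAntiParaKahler e.target (localMetric g e) (localEnd φ e) where
  isOpen := e.open_target
  metric_smooth := contDiffOn_localMetric g he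
  end_smooth := contDiffOn_localEnd hK he
  symm x _ a b := g.symm _ _ _
  pos x hx a ha := by
    refine g.pos _ _ fun h0 ↦ ha ?_
    rw [← chartDeriv_chartSymmDeriv he hx a]
    exact (congrArg (chartDeriv e (e.symm x)) h0).trans (map_zero _)
  selfAdjoint x hx a b := by
    have h1 : ∀ c, chartSymmDeriv e x (localEnd φ e x c) = φ _ (chartSymmDeriv e x c) :=
      fun c ↦ chartSymmDeriv_chartDeriv he hx _
    -- Compatibility and `φ² = id` give `g(φa, b) = g(φφa, φb) = g(a, φb)`.
    rw [localMetric_apply, localMetric_apply, h1, h1, ← hK.compatible, hK.involutive]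
  parallel x hx a b := by
    have h1 := hK.parallel e he x hx a b
    have hd : DifferentiableAt ℝ (localEnd φ e) x :=
      ((contDiffOn_localEnd hK he).contDiffAt (e.open_target.mem_nhds hx)).differentiableAt
        (by simp)
    simp only [leviCivita, covDeriv, fderiv_fun_const, Pi.zero_apply, zero_apply, zero_add] at h1
    rw [(hd.hasFDerivAt.clm_apply (hasFDerivAt_const b x)).fderiv] at h1
    simp at h1
    rw [eq_sub_iff_add_eq]
    exact sub_eq_zero.mp h1

end Chart

end BergerSasaki

/-! ### The theorem on the manifold. -/

theorem mainTheorem9 (k : ℕ) {M : Type*} [TopologicalSpace M]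
    [ChartedSpace (EuclideanSpace ℝ (Fin (2 * k))) M]
    [IsManifold 𝓘(ℝ, EuclideanSpace ℝ (Fin (2 * k))) ∞ M]
    (g : ContMDiffRiemannianMetric 𝓘(ℝ, EuclideanSpace ℝ (Fin (2 * k))) ∞
      (EuclideanSpace ℝ (Fin (2 * k)))
      (fun p : M ↦ TangentSpace 𝓘(ℝ, EuclideanSpace ℝ (Fin (2 * k))) p))
    (φ : (p : M) → TangentSpace 𝓘(ℝ, EuclideanSpace ℝ (Fin (2 * k))) p →L[ℝ]
      TangentSpace 𝓘(ℝ, EuclideanSpace ℝ (Fin (2 * k))) p)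
    (hK : BergerSasaki.IsAntiParaKahler g φ) (δ : ℝ) :
    (∀ e ∈ IsManifold.maximalAtlas 𝓘(ℝ, EuclideanSpace ℝ (Fin (2 * k))) ∞ M,
      ∀ v : TangentBundle 𝓘(ℝ, EuclideanSpace ℝ (Fin (2 * k))) M, v.proj ∈ e.source →
      letI G := BergerSasaki.localMetric g e
      letI z := BergerSasaki.inducedChart e v
      letI β := BergerSasaki.identityForm δ G (BergerSasaki.localEnd φ e) z
      letI Eh := BergerSasaki.horFrame G z
      letI Ev := BergerSasaki.verFrame (n := 2 * k)
      (∀ i j, β (Eh i) (Eh j) = 0) ∧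
      (∀ i j, β (Ev i) (Ev j) = 0) ∧
      (∀ i j, β (Ev i) (Eh j) =
        (1 / 4 : ℝ) • ∑ h, BergerSasaki.raisedCurvature G z h j i • Eh h) ∧
      (∀ i j, β (Eh j) (Ev i) =
        (1 / 4 : ℝ) • ∑ h, BergerSasaki.raisedCurvature G z h j i • Eh h) ∧
      BergerSasaki.identityTension δ G (BergerSasaki.localEnd φ e) z = 0) ∧
    (BergerSasaki.CurvatureNeZero g → BergerSasaki.IdentityFormNeZero δ g φ) := by
  refine ⟨fun e he v hv ↦ ?_, ?_⟩
  · have h := hK.isLocalAntiParaKahler he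
    have hz : (BergerSasaki.inducedChart e v).1 ∈ e.target := e.map_source hv
    refine ⟨fun i j ↦ h.identityForm_hLift_hLift hz δ _ _,
      fun i j ↦ h.identityForm_vLift_vLift hz δ _ _,
      fun i j ↦ h.identityForm_verFrame_horFrame hz δ i j, fun i j ↦ ?_,
      h.metricTrace_identityForm hz _ δ⟩
    rw [h.identityForm_comm hz]
    exact h.identityForm_verFrame_horFrame hz δ i j
  · rintro ⟨e, he, p, hp, a, b, c, hR⟩
    have h := hK.isLocalAntiParaKahler he
    -- The chart differential is onto, so some tangent vector at `p` has fibre coordinate `u = c`;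
    -- there `R(a, b)u` is the nonzero vector `R(a, b)c`.
    obtain ⟨w, hw⟩ :=
      (BergerSasaki.mdifferentiable_of_mem_maximalAtlas he).mfderiv_surjective hp c
    have hz : (e p, c).1 ∈ e.target := e.map_source hp
    have hind : BergerSasaki.inducedChart e ⟨p, w⟩ = (e p, c) := Prod.ext rfl hw
    refine ⟨e, he, ⟨p, w⟩, hp,
      BergerSasaki.vLift (BergerSasaki.riemann (BergerSasaki.localMetric g e) (e p) a b c),
      BergerSasaki.hLift (BergerSasaki.localMetric g e) (e p, c) b, fun h0 ↦ ?_⟩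
    rw [hind] at h0
    -- Pairing with `a` gives `¼ g(R(a, b)c, R(a, b)c)`, which is positive.
    have h1 := h.identityForm_vLift_hLift_apply hz δ
      (BergerSasaki.riemann (BergerSasaki.localMetric g e) (e p) a b c) b a
    rw [h0] at h1
    have h2 := h.pos _ hz _ hR
    simp only [Prod.fst_zero, map_zero, zero_apply] at h1
    linarith
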